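/- Let $M$ be a finite-dimensional smooth manifold, let $f(u,q)$ be a smooth family of vector fields on $M$ and $L(u,q)$ a smooth function, $u\in\mathbb R^k$, $q\in M$, and let $0\le t_0<t_1\le T$. Let $\Omega$ be the Banach manifold of admissible pairs $\omega=(q(\cdot),u(\cdot))$ with $u\in L^\infty([0,T],\mathbb R^k)$, $q$ Lipschitz and $\dot q=f(u,q)$ almost everywhere on $[0,T]$. Write $F_t(\omega)=q(t)$ and $J_{t_0}^{t_1}(\omega)=\int_{t_0}^{t_1}L(u,q)\,dt$. For a map $F$ from a Banach manifold $\mathcal U$ to a finite-dimensional manifold $P$, a functional $J:\mathcal U\to\mathbb R$ and a number $\nu$, a pair $(\omega,\lambda)$ with $\lambda\in T^*_{F(\omega)}P$ is a Lagrange point of $(F,J)$ if $\langle\lambda,dF[\omega](w)\rangle-\nu\,dJ[\omega](w)=0$ for all $w\in T_\omega\mathcal U$. In local coordinates put $Q(v,w)=\langle\lambda,d^2F[\omega](v,w)\rangle-\nu\,d^2J[\omega](v,w)$. For a finite-dimensional $W\subset T_\omega\mathcal U$, the $\mathcal L$-derivative $\mathcal L(F,\nu J)[\omega,\lambda](W)\subset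 T_\lambda(T^*P)$ is the set of vectors $(\xi,dF[\omega](v))$, in canonical coordinates, with $v\in W$ and $\langle\xi,dF[\omega](w)\rangle+Q(v,w)=0$ for all $w\in W$. For an arbitrary subspace $V$, $\mathcal L(F,\nu J)[\omega,\lambda](V)$ is the limit in the Grassmannian, when it exists, of $\mathcal L(F,\nu J)[\omega,\lambda](W)$ over the finite-dimensional subspaces $W\subset V$ directed by inclusion; if $V=T_\omega\mathcal U$, it is omitted from the notation. Let $\nu\in\mathbb R$ (in applications $\nu\in\{0,1\}$), let $N_0\subset M$ be an embedded submanifold, let $\omega\in F_{t_0}^{-1}(N_0)$, $q_0=F_{t_0}(\omega)$, and let $(\omega,(-\lambda(t_0),\lambda(t_1)))$ be a Lagrange point of $((F_{t_0},F_{t_1}),J_{t_0}^{t_1})$, where $(F_{t_0},F_{t_1}):\Omega\to M\times M$. Let $\pi_0,\pi_1$ be the projections of $T_{-\lambda(t_0)}(T^*M)\times T_{\lambda(t_1)}(T^*M)$ to its two factors. Suppose that $\lambda(t_0)$ annihilates $T_{q_0}N_0$. Then: 1. $(\omega,\lambda(t_1))$ is a Lagrange point of the problem with initial point in $N_0$,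 that is, of the restriction of $(F_{t_1},J_{t_0}^{t_1})$ to $F_{t_0}^{-1}(N_0)$: $$\langle\lambda(t_1),dF_{t_1}[\omega](w)\rangle-\nu\,dJ_{t_0}^{t_1}[\omega](w)=0\qquad\text{for all } w\in T_\omega F_{t_0}^{-1}(N_0).$$ 2. If the $\mathcal L$-derivative $\mathcal L(F_{t_0},F_{t_1},\nu J_{t_0}^{t_1})[\omega,(-\lambda(t_0),\lambda(t_1))]$ exists, then so does that of the problem with initial point in $N_0$, and $$\mathcal L(F_{t_1},\nu J_{t_0}^{t_1})[\omega,\lambda(t_1)]\bigl(T_\omega F_{t_0}^{-1}(N_0)\bigr)=\pi_1\Bigl(\mathcal L(F_{t_0},F_{t_1},\nu J_{t_0}^{t_1})[\omega,(-\lambda(t_0),\lambda(t_1))]\cap\pi_0^{-1}\bigl(T_{q_0}^\perp N_0\times T_{q_0}N_0\bigr)\Bigr).$$ Here $T_{q_0}^\perp N_0\subset T^*_{q_0}M$ is the annihilator of $T_{q_0}N_0$, and $T_{q_0}^\perp N_0\times T_{q_0}N_0$ is regarded as a subspace of $T_{-\lambda(t_0)}(T^*M)$ by means of the canonical coordinates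 of $T^*M$ induced by a chart of $M$ around $q_0$ in which $N_0$ is an open piece of an affine subspace; on $\Omega$ one uses the coordinates $(q(t_0),u)$, with $q(t_0)$ written in that chart, so that $F_{t_0}^{-1}(N_0)$ is also an open piece of an affine subspace. -/

import Mathlib

open Set Filter Topology MeasureTheory
open scoped Manifold ContDiff ENNReal NNReal

namespace LDeriv

noncomputable section

/-! ### Limits in the Grassmannian -/

/-- The neighbourhood filter of `Λ` in the Grassmannian of the finite-dimensional space `G`.
The Grassmannian is the quotient of the space of injective linear maps `Λ → G` by `GL(Λ)`; the
quotient map `T ↦ range T` is open, so the neighbourhoods of `Λ` are the images of the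
neighbourhoods of the inclusion of `Λ`. -/
def grassmannNhds {G : Type*} [NormedAddCommGroup G] [NormedSpace ℝ G] (Λ : Submodule ℝ G) :
    Filter (Submodule ℝ G) :=
  Filter.map (fun T : Λ →L[ℝ] G => LinearMap.range (T : Λ →ₗ[ℝ] G)) (𝓝 Λ.subtypeL)

/-- The finite-dimensional subspaces of `V`, directed by inclusion. -/
abbrev FinDimSub {X : Type*} [AddCommGroup X] [Module ℝ X] (V : Submodule ℝ X) : Type _ :=
  {W : Submodule ℝ X // W ≤ V ∧ FiniteDimensional ℝ W}

/-! ### First and second differentials, Lagrange points, `𝓛`-derivatives -/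

section General

variable {X : Type*} [NormedAddCommGroup X] [NormedSpace ℝ X]
variable {B : Type*} [NormedAddCommGroup B] [NormedSpace ℝ B]
variable {B' : Type*} [NormedAddCommGroup B'] [NormedSpace ℝ B']

/-- The second differential of `g` at `x`, as the symmetric bilinear map whose quadratic map is
`v ↦ d²g[x](v, v)`. For a map `g` of class `C²` near `x` the two summands are equal. -/
def secondDiff (g : X → B) (x : X) : X →L[ℝ] X →L[ℝ] B :=
  (1 / 2 : ℝ) • (fderiv ℝ (fderiv ℝ g) x + (fderiv ℝ (fderiv ℝ g) x).flip)

variable (X B) in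
/-- The first and second differentials at a point, in local coordinates, of a constrained
variational problem `(F, J)`, where `F` takes values in a manifold modelled on `B`
and `J` is the functional. -/
structure TwoJet where
  dF : X →L[ℝ] B
  ddF : X →L[ℝ] X →L[ℝ] B
  dJ : X →L[ℝ] ℝ
  ddJ : X →L[ℝ] X →L[ℝ] ℝ

/-- The differentials at `x` of the problem `(g, j)`. -/
def TwoJet.of (g : X → B) (j : X → ℝ) (x : X) : TwoJet X B where
  dF := fderiv ℝ g x
  ddF := secondDiff g x
  dJ := fderiv ℝ j x
  ddJ := secondDiff j x

/-- The differentials at `x` of the problem `((g₀, g₁), j)`; those of the map `(g₀, g₁)`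
are taken componentwise. -/
def TwoJet.ofPair (g₀ : X → B) (g₁ : X → B') (j : X → ℝ) (x : X) : TwoJet X (B × B') where
  dF := (fderiv ℝ g₀ x).prod (fderiv ℝ g₁ x)
  ddF :=
    ((ContinuousLinearMap.compL ℝ X B (B × B')) (ContinuousLinearMap.inl ℝ B B')).comp
        (secondDiff g₀ x) +
      ((ContinuousLinearMap.compL ℝ X B' (B × B')) (ContinuousLinearMap.inr ℝ B B')).comp
        (secondDiff g₁ x)
  dJ := fderiv ℝ j x
  ddJ := secondDiff j x

/-- The Lagrange multiplier rule `⟨p, dF w⟩ - ν dJ w = 0` for all variations `w ∈ V`. -/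
def IsLagrangePoint (j : TwoJet X B) (p : StrongDual ℝ B) (ν : ℝ) (V : Submodule ℝ X) : Prop :=
  ∀ w ∈ V, p (j.dF w) - ν * j.dJ w = 0

/-- The form `Q(v, w) = ⟨p, d²F(v, w)⟩ - ν d²J(v, w)`. -/
def secondVariation (j : TwoJet X B) (p : StrongDual ℝ B) (ν : ℝ) (v w : X) : ℝ :=
  p (j.ddF v w) - ν * j.ddJ v w

/-- The `𝓛`-derivative over a finite-dimensional space of variations `W`: the vectors
`(ξ, dF v)` with `v ∈ W` and `⟨ξ, dF w⟩ + Q(v, w) = 0` for all `w ∈ W`. The tangent space at a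
covector of the cotangent bundle is written as `B* × B` by the canonical coordinates. -/
def lDerivOver (j : TwoJet X B) (p : StrongDual ℝ B) (ν : ℝ) (W : Submodule ℝ X) :
    Submodule ℝ (StrongDual ℝ B × B) where
  carrier := {z | ∃ v ∈ W, z.2 = j.dF v ∧
    ∀ w ∈ W, z.1 (j.dF w) + secondVariation j p ν v w = 0}
  zero_mem' := ⟨0, W.zero_mem, by simp, fun w _ => by simp [secondVariation]⟩
  add_mem' := by
    rintro a b ⟨v, hv, hav, ha⟩ ⟨v', hv', hbv, hb⟩
    refine ⟨v + v', W.add_mem hv hv', by simp [hav, hbv], fun w hw => ?_⟩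
    have h1 := ha w hw
    have h2 := hb w hw
    simp only [secondVariation, map_add, add_apply, Prod.fst_add] at *
    linarith
  smul_mem' := by
    rintro c a ⟨v, hv, hav, ha⟩
    refine ⟨c • v, W.smul_mem c hv, by simp [hav], fun w hw => ?_⟩
    have h1 := ha w hw
    simp only [secondVariation, map_smul, smul_apply, Prod.smul_fst,
      smul_eq_mul] at *
    linear_combination c * h1

/-- `Λ` is the `𝓛`-derivative over an arbitrary space of variations `V`: the limit in the
Grassmannian of the `𝓛`-derivatives over the increasing finite-dimensional subspaces of `V`. -/
def IsLDerivative (j : TwoJet X B) (p : StrongDual ℝ B) (ν : ℝ) (V : Submodule ℝ X)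
    (Λ : Submodule ℝ (StrongDual ℝ B × B)) : Prop :=
  Tendsto (fun W : FinDimSub V => lDerivOver j p ν W.1) atTop (grassmannNhds Λ)

/-- The projection `π₀ : T(T*(M × M')) → T(T*M)` in canonical coordinates. -/
def proj₀ : (StrongDual ℝ (B × B') × (B × B')) →ₗ[ℝ] (StrongDual ℝ B × B) where
  toFun z := (z.1.comp (ContinuousLinearMap.inl ℝ B B'), z.2.1)
  map_add' _ _ := rfl
  map_smul' _ _ := rfl

/-- The projection `π₁ : T(T*(M × M')) → T(T*M')` in canonical coordinates. -/
def proj₁ : (StrongDual ℝ (B × B') × (B × B')) →ₗ[ℝ] (StrongDual ℝ B' × B') where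
  toFun z := (z.1.comp (ContinuousLinearMap.inr ℝ B B'), z.2.2)
  map_add' _ _ := rfl
  map_smul' _ _ := rfl

/-- The plane `S^⊥ × S`. -/
def annihilatorProd (S : Submodule ℝ B) : Submodule ℝ (StrongDual ℝ B × B) where
  carrier := {z | (∀ s ∈ S, z.1 s = 0) ∧ z.2 ∈ S}
  zero_mem' := ⟨fun _ _ => rfl, S.zero_mem⟩
  add_mem' := fun ha hb =>
    ⟨fun s hs => by simp [ha.1 s hs, hb.1 s hs], S.add_mem ha.2 hb.2⟩
  smul_mem' := fun c _ ha => ⟨fun s hs => by simp [ha.1 s hs], S.smul_mem c ha.2⟩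

end General

/-! ### Charts, submanifolds and covectors -/

section Manifold

variable {E : Type*} [NormedAddCommGroup E] [NormedSpace ℝ E]
variable {M : Type*} [TopologicalSpace M] [ChartedSpace E M]

/-- `N₀` is an embedded submanifold of `M` near its point `q`, and `φ` is a smooth slice chart
around `q`: in the domain of `φ`, the set `N₀` is the affine subspace `φ q + S`. -/
structure IsSliceChart (N₀ : Set M) (φ : OpenPartialHomeomorph M E) (q : M)
    (S : Submodule ℝ E) : Prop where
  smooth : φ ∈ IsManifold.maximalAtlas 𝓘(ℝ, E) ∞ M
  mem_source : q ∈ φ.source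
  mem_set : q ∈ N₀
  mem_iff : ∀ y ∈ φ.source, y ∈ N₀ ↔ φ y - φ q ∈ S

/-- `N₀` is an embedded submanifold of `M`. -/
def IsEmbeddedSubmanifold (N₀ : Set M) : Prop :=
  ∀ q ∈ N₀, ∃ (φ : OpenPartialHomeomorph M E) (S : Submodule ℝ E), IsSliceChart N₀ φ q S

/-- The coordinate frame of the chart `φ` at `q`: the differential of `φ⁻¹` at `φ q`. -/
def chartFrame (φ : OpenPartialHomeomorph M E) (q : M) : E →L[ℝ] TangentSpace 𝓘(ℝ, E) q :=
  mfderiv 𝓘(ℝ, E) 𝓘(ℝ, E) φ.symm (φ q)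

/-- The tangent space at `q` of a submanifold with slice chart `φ` and slice direction `S`. -/
def sliceTangentSpace (φ : OpenPartialHomeomorph M E) (q : M) (S : Submodule ℝ E) :
    Submodule ℝ (TangentSpace 𝓘(ℝ, E) q) :=
  S.map (chartFrame φ q : E →ₗ[ℝ] TangentSpace 𝓘(ℝ, E) q)

/-- The coordinates in the chart `φ` of a covector at `q`. -/
def covectorCoord (φ : OpenPartialHomeomorph M E) (q : M)
    (l : TangentSpace 𝓘(ℝ, E) q →L[ℝ] ℝ) : StrongDual ℝ E :=
  l.comp (chartFrame φ q)

end Manifold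

/-! ### Control systems -/

/-- Essentially bounded controls `[0, T] → ℝᵏ`. -/
abbrev Control (k : ℕ) (T : ℝ) : Type :=
  Lp (EuclideanSpace ℝ (Fin k)) ∞ (volume.restrict (Icc (0 : ℝ) T))

/-- The control system `q' = f(u, q)` with controls in `ℝᵏ` and the integrand `L(u, q)` of the
functional, both smooth in `(u, q)`. -/
structure ControlSystem (k : ℕ) (E : Type*) [NormedAddCommGroup E] [NormedSpace ℝ E]
    (M : Type*) [TopologicalSpace M] [ChartedSpace E M] [IsManifold 𝓘(ℝ, E) ∞ M] where
  f : EuclideanSpace ℝ (Fin k) → (q : M) → TangentSpace 𝓘(ℝ, E) q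
  L : EuclideanSpace ℝ (Fin k) → M → ℝ
  smooth_f : ContMDiff (𝓘(ℝ, EuclideanSpace ℝ (Fin k)).prod 𝓘(ℝ, E)) 𝓘(ℝ, E).tangent ∞
    (fun z : EuclideanSpace ℝ (Fin k) × M => (⟨z.2, f z.1 z.2⟩ : TangentBundle 𝓘(ℝ, E) M))
  smooth_L : ContMDiff (𝓘(ℝ, EuclideanSpace ℝ (Fin k)).prod 𝓘(ℝ, E)) 𝓘(ℝ, ℝ) ∞
    (fun z : EuclideanSpace ℝ (Fin k) × M => L z.1 z.2)

namespace ControlSystem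

variable {k : ℕ} {E : Type*} [NormedAddCommGroup E] [NormedSpace ℝ E]
variable {M : Type*} [TopologicalSpace M] [ChartedSpace E M] [IsManifold 𝓘(ℝ, E) ∞ M]

/-- `(q, u)` is an admissible pair on `[0, T]`: `q` is a (locally, in charts) Lipschitz curve on
`[0, T]` with `q'(t) = f(u(t), q(t))` for almost every `t`. -/
structure IsAdmissible (𝒮 : ControlSystem k E M) (T : ℝ) (q : ℝ → M) (u : Control k T) :
    Prop where
  continuousOn : ContinuousOn q (Icc 0 T)
  lipschitz : ∀ s ∈ Icc (0 : ℝ) T, ∃ C : ℝ≥0, ∃ O ∈ 𝓝[Icc (0 : ℝ) T] s,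
    MapsTo q O (chartAt E (q s)).source ∧ LipschitzOnWith C (fun t => chartAt E (q s) (q t)) O
  ode : ∀ᵐ t ∂(volume.restrict (Icc (0 : ℝ) T)),
    HasMFDerivWithinAt 𝓘(ℝ, ℝ) 𝓘(ℝ, E) q (Icc 0 T) t
      ((1 : ℝ →L[ℝ] ℝ).smulRight (𝒮.f (u t) (q t)))

open Classical in
/-- The trajectory on `[0, T]` with control `u` that passes through `a` at the time `t₀`
(the constant curve `a` if there is none). -/
def trajectory (𝒮 : ControlSystem k E M) (T t₀ : ℝ) (a : M) (u : Control k T) : ℝ → M :=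
  if h : ∃ q : ℝ → M, 𝒮.IsAdmissible T q u ∧ q t₀ = a then h.choose else fun _ => a

/-- The evaluation map `F_t` on the Banach manifold of admissible pairs, in local coordinates.
An admissible pair `(q, u)` near the given one has the coordinates `(x, u)`, where `x = φ₀(q(t₀))`,
and the values `q(t)` are written in the chart `φ`. -/
def evalCoord (𝒮 : ControlSystem k E M) (T t₀ : ℝ) (φ₀ φ : OpenPartialHomeomorph M E) (t : ℝ)
    (z : E × Control k T) : E :=
  φ (𝒮.trajectory T t₀ (φ₀.symm z.1) z.2 t)

/-- The functional `J_{t₀}^{t₁}(q, u) = ∫_{t₀}^{t₁} L(u, q) dt` in the same coordinates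
`(φ₀(q(t₀)), u)` on the manifold of admissible pairs. -/
def costCoord (𝒮 : ControlSystem k E M) (T t₀ t₁ : ℝ) (φ₀ : OpenPartialHomeomorph M E)
    (z : E × Control k T) : ℝ :=
  ∫ t in t₀..t₁, 𝒮.L (z.2 t) (𝒮.trajectory T t₀ (φ₀.symm z.1) z.2 t)

/-- The differentials of `(F_{t₀}, F_{t₁}, J_{t₀}^{t₁})` at the admissible pair `(q, u)`. -/
def twoPointJet (𝒮 : ControlSystem k E M) (T t₀ t₁ : ℝ) (φ₀ φ₁ : OpenPartialHomeomorph M E)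
    (q : ℝ → M) (u : Control k T) : TwoJet (E × Control k T) (E × E) :=
  TwoJet.ofPair (𝒮.evalCoord T t₀ φ₀ φ₀ t₀) (𝒮.evalCoord T t₀ φ₀ φ₁ t₁)
    (𝒮.costCoord T t₀ t₁ φ₀) (φ₀ (q t₀), u)

/-- The differentials of `(F_{t₁}, J_{t₀}^{t₁})` at the admissible pair `(q, u)`. -/
def endPointJet (𝒮 : ControlSystem k E M) (T t₀ t₁ : ℝ) (φ₀ φ₁ : OpenPartialHomeomorph M E)
    (q : ℝ → M) (u : Control k T) : TwoJet (E × Control k T) E :=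
  TwoJet.of (𝒮.evalCoord T t₀ φ₀ φ₁ t₁) (𝒮.costCoord T t₀ t₁ φ₀) (φ₀ (q t₀), u)

/-- The tangent space at `(q, u)` of `F_{t₀}⁻¹(N₀)`, that is `(dF_{t₀})⁻¹(T N₀)`, where `φ₀` is a
slice chart for `N₀` with direction `S`. In the coordinates `(φ₀(q(t₀)), u)` the submanifold
`F_{t₀}⁻¹(N₀)` is itself an affine subspace with this direction, so the second differential of
the restriction of a map to it is the restriction of the second differential. -/
def startTangentSpace (𝒮 : ControlSystem k E M) (T t₀ : ℝ) (φ₀ : OpenPartialHomeomorph M E)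
    (q : ℝ → M) (u : Control k T) (S : Submodule ℝ E) : Submodule ℝ (E × Control k T) :=
  S.comap (fderiv ℝ (𝒮.evalCoord T t₀ φ₀ φ₀ t₀) (φ₀ (q t₀), u) : E × Control k T →ₗ[ℝ] E)

end ControlSystem

end

end LDeriv

namespace LDeriv

open Module

noncomputable section

/-! ### The canonical symplectic form and Lagrangian subspaces -/

section Symplectic

variable {B : Type*} [NormedAddCommGroup B] [NormedSpace ℝ B]

/-! The differential of `F_{t₀}` in the coordinates `(q(t₀), u)` is the projection to the first
factor, and its second differential is zero. So `-λ(t₀)` drops out of the second variation, and both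
problems carry the same symmetric form `Q`. Since `λ(t₀)` kills `T N₀`, the multiplier rule on
`F_{t₀}⁻¹(N₀)` is immediate. What remains is linear algebra about `A = (A₀, A₁)` with `A₀` onto, a
form `Q`, and `V = A₀⁻¹(S)`.

All planes over finite-dimensional spaces are Lagrangian (`orthogonal_lagrangePlane`), hence so is
their limit `Λ`, and its symplectic reduction by `S^⊥ × S` has at least the dimension of a
Lagrangian plane (`orthogonal_reduction_le`). By `tendsto_grassmannNhds_of_near` it therefore
suffices that each vector of the reduction is close to the planes over all large `W ⊂ V`. This does
not follow formally, because reduction is discontinuous at planes that are not transversal to the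
coisotropic subspace. The argument splits by the indices of `Q` and `-Q` on `V`.

If one index is finite, flipping the sign of `Q` on a maximal definite subspace gives a seminorm `g`
that dominates `Q`. Two approximate solutions over different spaces have close corrections in `g`
(`seminorm_sub_le`), so one element of `V` solves the restricted equation approximately against
every `w ∈ V`, with an error measured by `g w + ‖A₁ w‖` (`exists_approx_of_mem_reduction`). Such a
solution forces closeness to the planes, by symplectic duality (`eventually_near_of_seminorm`).

If both indices are infinite, `W` can be enlarged by vectors of `ker A` that are `Q`-orthogonal to
`W` and have any prescribed square. This moves the plane by arbitrary transvections, so convergence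
is possible only if these act trivially. The planes are then eventually constant and every vector of
`Λ` comes from an exact solution (`exists_forall_of_tendsto_of_indefinite`). -/

variable (B) in
/-- The canonical symplectic form of `B* × B`. -/
def sympForm : LinearMap.BilinForm ℝ (StrongDual ℝ B × B) :=
  LinearMap.mk₂ ℝ (fun z z' => z.1 z'.2 - z'.1 z.2)
    (fun a b c => by simp; ring) (fun c a b => by simp; ring)
    (fun a b c => by simp; ring) (fun c a b => by simp; ring)

@[simp] theorem sympForm_apply (z z' : StrongDual ℝ B × B) :
    sympForm B z z' = z.1 z'.2 - z'.1 z.2 := rfl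

theorem sympForm_isRefl : (sympForm B).IsRefl := fun z z' h => by
  simp only [sympForm_apply] at *
  linarith

theorem sympForm_nondegenerate : (sympForm B).Nondegenerate := by
  have key : ∀ z : StrongDual ℝ B × B, (∀ z', sympForm B z z' = 0) → z = 0 := by
    intro z hz
    have h1 : z.1 = 0 := by
      ext x
      simpa using hz (0, x)
    have h2 : z.2 = 0 := by
      by_contra hne
      obtain ⟨g, hg⟩ := SeparatingDual.exists_ne_zero (R := ℝ) hne
      exact hg (by simpa using hz (g, 0))
    exact Prod.ext h1 h2
  exact ⟨key, fun z hz => key z fun z' => sympForm_isRefl _ _ (hz z')⟩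

theorem abs_sympForm_le (z z' : StrongDual ℝ B × B) :
    |sympForm B z z'| ≤ 2 * ‖z‖ * ‖z'‖ := by
  have h1 : |z.1 z'.2| ≤ ‖z‖ * ‖z'‖ := (z.1.le_opNorm _).trans
    (mul_le_mul (norm_fst_le z) (norm_snd_le z') (norm_nonneg _) (norm_nonneg _))
  have h2 : |z'.1 z.2| ≤ ‖z'‖ * ‖z‖ := (z'.1.le_opNorm _).trans
    (mul_le_mul (norm_fst_le z') (norm_snd_le z) (norm_nonneg _) (norm_nonneg _))
  calc |z.1 z'.2 - z'.1 z.2| ≤ |z.1 z'.2| + |z'.1 z.2| := abs_sub _ _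
    _ ≤ _ := by linarith

variable [FiniteDimensional ℝ B]

theorem finrank_strongDual : finrank ℝ (StrongDual ℝ B) = finrank ℝ B := by
  rw [← Subspace.dual_finrank_eq (K := ℝ) (V := B)]
  exact (LinearMap.toContinuousLinearMap (𝕜 := ℝ) (E := B) (F' := ℝ)).symm.finrank_eq

instance : FiniteDimensional ℝ (StrongDual ℝ B) :=
  (LinearMap.toContinuousLinearMap (𝕜 := ℝ) (E := B) (F' := ℝ)).finiteDimensional

theorem finrank_orthogonal_sympForm (Λ : Submodule ℝ (StrongDual ℝ B × B)) :
    finrank ℝ ((sympForm B).orthogonal Λ) = finrank ℝ B + finrank ℝ B - finrank ℝ Λ := by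
  have h := LinearMap.BilinForm.finrank_orthogonal (sympForm_nondegenerate (B := B)) Λ
  have h2 : finrank ℝ (StrongDual ℝ B × B) = finrank ℝ B + finrank ℝ B :=
    finrank_prod.trans (congrArg (· + finrank ℝ B) finrank_strongDual)
  exact h.trans (congrArg (· - finrank ℝ Λ) h2)

theorem orthogonal_orthogonal_sympForm (Λ : Submodule ℝ (StrongDual ℝ B × B)) :
    (sympForm B).orthogonal ((sympForm B).orthogonal Λ) = Λ :=
  LinearMap.BilinForm.orthogonal_orthogonal sympForm_nondegenerate sympForm_isRefl Λ

theorem finrank_le_of_isotropic {Λ : Submodule ℝ (StrongDual ℝ B × B)}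
    (h : Λ ≤ (sympForm B).orthogonal Λ) : finrank ℝ Λ ≤ finrank ℝ B := by
  have h1 := Submodule.finrank_mono h
  have h2 := finrank_orthogonal_sympForm Λ
  omega

theorem le_finrank_of_coisotropic {Λ : Submodule ℝ (StrongDual ℝ B × B)}
    (h : (sympForm B).orthogonal Λ ≤ Λ) : finrank ℝ B ≤ finrank ℝ Λ := by
  have h1 := Submodule.finrank_mono h
  have h2 := finrank_orthogonal_sympForm Λ
  omega

theorem orthogonal_eq_of_isotropic {Λ : Submodule ℝ (StrongDual ℝ B × B)}
    (h : Λ ≤ (sympForm B).orthogonal Λ) (hd : finrank ℝ B ≤ finrank ℝ Λ) :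
    (sympForm B).orthogonal Λ = Λ := by
  have h2 := finrank_orthogonal_sympForm Λ
  exact (Submodule.eq_of_le_of_finrank_le h (by omega)).symm

/-- A vector whose symplectic product with a Lagrangian subspace is small is close to it. -/
theorem exists_near_of_abs_sympForm_le {Λ : Submodule ℝ (StrongDual ℝ B × B)}
    (h : (sympForm B).orthogonal Λ ≤ Λ) {z : StrongDual ℝ B × B} {ε : ℝ} (hε : 0 ≤ ε)
    (hz : ∀ z' ∈ Λ, |sympForm B z' z| ≤ ε * ‖z'‖) : ∃ z' ∈ Λ, ‖z - z'‖ ≤ ε := by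
  -- The pairing with `z` on `Λ` has norm at most `ε`. A Hahn–Banach extension is the pairing with
  -- some `(η, x)` of norm at most `ε`, and `z - (η, x)` is then orthogonal to `Λ`, hence in `Λ`.
  let f₀ : Λ →ₗ[ℝ] ℝ := LinearMap.flip (sympForm B) z ∘ₗ Λ.subtype
  let f : StrongDual ℝ Λ := f₀.mkContinuous ε (fun y : Λ => hz (y : StrongDual ℝ B × B) y.2)
  obtain ⟨g, hg, hgn⟩ := exists_extension_norm_eq Λ f
  have hgε : ‖g‖ ≤ ε := hgn ▸ LinearMap.mkContinuous_norm_le _ hε _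
  -- the vector that represents `g`
  let η : StrongDual ℝ B := -(g.comp (ContinuousLinearMap.inr ℝ (StrongDual ℝ B) B))
  obtain ⟨x, hx⟩ : ∃ x : B, ∀ ξ : StrongDual ℝ B, g (ξ, 0) = ξ x := by
    let e := LinearMap.toContinuousLinearMap (𝕜 := ℝ) (E := B) (F' := ℝ)
    let φ : Dual ℝ (Dual ℝ B) :=
      (g : (StrongDual ℝ B × B) →ₗ[ℝ] ℝ) ∘ₗ LinearMap.inl ℝ _ _ ∘ₗ e.toLinearMap
    refine ⟨(evalEquiv ℝ B).symm φ, fun ξ => ?_⟩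
    have := apply_evalEquiv_symm_apply (R := ℝ) (M := B) (e.symm ξ) φ
    have h3 : φ (e.symm ξ) = g (ξ, 0) := by simp [φ]
    rw [← h3, ← this]
    rfl
  have hxn : ‖x‖ ≤ ε := by
    refine (NormedSpace.norm_le_dual_bound ℝ x hε fun ξ => ?_)
    rw [← hx]
    refine (g.le_opNorm _).trans (mul_le_mul hgε ?_ (norm_nonneg _) hε)
    simp [Prod.norm_def]
  have hηn : ‖η‖ ≤ ε := by
    refine ContinuousLinearMap.opNorm_le_bound _ hε fun y => ?_
    have : η y = - g (0, y) := rfl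
    rw [this, norm_neg]
    refine (g.le_opNorm _).trans (mul_le_mul hgε ?_ (norm_nonneg _) hε)
    simp [Prod.norm_def]
  refine ⟨z - (η, x), h fun y hy => ?_, ?_⟩
  · have h1 : g y = sympForm B y z := hg ⟨y, hy⟩
    have h2 : g y = y.1 x - η y.2 := by
      have : y = (y.1, 0) + (0, y.2) := by simp
      rw [this, map_add, hx]
      simp [η]
    change sympForm B y (z - (η, x)) = 0
    rw [map_sub, ← h1, h2]
    simp
  · rw [sub_sub_cancel, Prod.norm_def]
    exact max_le hηn hxn

end Symplectic

/-! ### Convergence in the Grassmannian -/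

section Grassmann

variable {G : Type*} [NormedAddCommGroup G] [NormedSpace ℝ G]
variable {ι : Type*} {l : Filter ι} {F : ι → Submodule ℝ G} {Λ : Submodule ℝ G}

theorem exists_forall_norm_sub_lt_mem {T₀ : Λ →L[ℝ] G} {s : Set (Λ →L[ℝ] G)} (hs : s ∈ 𝓝 T₀) :
    ∃ δ > 0, ∀ T : Λ →L[ℝ] G, ‖T - T₀‖ < δ → T ∈ s := by
  obtain ⟨δ, hδ, h⟩ := (Metric.mem_nhds_iff (α := Λ →L[ℝ] G)).1 hs
  exact ⟨δ, hδ, fun T hT => h ((dist_eq_norm T T₀).trans_lt hT)⟩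

theorem setOf_norm_sub_lt_mem_nhds (T₀ : Λ →L[ℝ] G) {δ : ℝ} (hδ : 0 < δ) :
    {T : Λ →L[ℝ] G | ‖T - T₀‖ < δ} ∈ 𝓝 T₀ := by
  filter_upwards [Metric.ball_mem_nhds T₀ hδ] with T hT
  exact (dist_eq_norm T T₀).symm.trans_lt hT

/-- Moving each vector of a basis of `Λ` to a nearby vector of `F i` defines a map close to the
inclusion, hence injective. Its range lies in `F i`, and the dimension bound makes it all of `F i`.
Thus one-sided closeness suffices once dimensions cannot jump up. -/
theorem tendsto_grassmannNhds_of_near [FiniteDimensional ℝ G]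
    (hd : ∀ᶠ i in l, finrank ℝ (F i) ≤ finrank ℝ Λ)
    (hn : ∀ z ∈ Λ, ∀ ε > 0, ∀ᶠ i in l, ∃ z' ∈ F i, ‖z - z'‖ ≤ ε) :
    Tendsto F l (grassmannNhds Λ) := by
  intro O hO
  obtain ⟨O', hO', hsub⟩ := Filter.mem_map_iff_exists_image.1 hO
  have hopen : {T : Λ →L[ℝ] G | Function.Injective T} ∈ 𝓝 Λ.subtypeL :=
    ContinuousLinearMap.isOpen_injective.mem_nhds Λ.subtype_injective
  obtain ⟨δ, hδ, hball⟩ := exists_forall_norm_sub_lt_mem (inter_mem hO' hopen)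
  let b := finBasis ℝ Λ
  obtain ⟨C, hC, hCb⟩ := b.exists_opNorm_le (F := G)
  have hε : 0 < δ / (2 * C) := by positivity
  have h1 : ∀ᶠ i in l, ∀ j, ∃ z' ∈ F i, ‖(b j : G) - z'‖ ≤ δ / (2 * C) :=
    eventually_all.2 fun j => hn _ (b j).2 _ hε
  change ∀ᶠ i in l, F i ∈ O
  filter_upwards [hd, h1] with i hdi hi
  choose z' hz' hzn using hi
  let T : Λ →L[ℝ] G := LinearMap.toContinuousLinearMap (b.constr ℝ z')
  have hTb : ∀ j, T (b j) = z' j := fun j => b.constr_basis ℝ z' j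
  have hT : ‖T - Λ.subtypeL‖ < δ := by
    have := hCb (u := T - Λ.subtypeL) hε.le fun j => by
      rw [sub_apply, hTb, norm_sub_rev]
      exact hzn j
    refine this.trans_lt ?_
    have : C * (δ / (2 * C)) = δ / 2 := by field_simp
    rw [this]
    linarith
  have hT' := hball T hT
  have hle : LinearMap.range (T : Λ →ₗ[ℝ] G) ≤ F i := by
    rintro _ ⟨y, rfl⟩
    change T y ∈ F i
    rw [← b.sum_repr y, map_sum]
    refine Submodule.sum_mem _ fun j _ => ?_
    rw [map_smul, hTb]
    exact (F i).smul_mem _ (hz' j)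
  have heq : LinearMap.range (T : Λ →ₗ[ℝ] G) = F i := by
    refine Submodule.eq_of_le_of_finrank_le hle ?_
    rwa [LinearMap.finrank_range_of_inj hT'.2]
  rw [← heq]
  exact hsub (mem_image_of_mem _ hT'.1)

theorem eventually_near_of_tendsto_grassmannNhds [FiniteDimensional ℝ G]
    (h : Tendsto F l (grassmannNhds Λ)) {ε : ℝ} (hε : 0 < ε) :
    ∀ᶠ i in l, finrank ℝ (F i) = finrank ℝ Λ ∧
      (∀ z ∈ Λ, ∃ z' ∈ F i, ‖z - z'‖ ≤ ε * ‖z‖) ∧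
      ∀ z' ∈ F i, ∃ z ∈ Λ, ‖z' - z‖ ≤ ε * ‖z'‖ := by
  have hopen : {T : Λ →L[ℝ] G | Function.Injective T} ∈ 𝓝 Λ.subtypeL :=
    ContinuousLinearMap.isOpen_injective.mem_nhds Λ.subtype_injective
  -- The bound `1 / 2` gives `‖z‖ ≤ 2 ‖T z‖`; the bound `ε / 2` absorbs this factor `2` when the
  -- error is measured by `‖T z‖`.
  set δ := min (1 / 2) (ε / 2) with hδ
  have hδ0 : 0 < δ := by positivity
  have hδ1 : δ ≤ 1 / 2 := min_le_left _ _
  have hδ2 : δ ≤ ε / 2 := min_le_right _ _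
  have := h (Filter.image_mem_map (inter_mem (setOf_norm_sub_lt_mem_nhds Λ.subtypeL hδ0) hopen))
  filter_upwards [this] with i hi
  obtain ⟨T, ⟨hT, hTi⟩, hTF⟩ := hi
  have hnear : ∀ z : Λ, ‖(z : G) - T z‖ ≤ δ * ‖z‖ := fun z => by
    rw [norm_sub_rev]
    refine ((T - Λ.subtypeL).le_opNorm z).trans ?_
    exact mul_le_mul_of_nonneg_right (le_of_lt hT) (norm_nonneg _)
  rw [← hTF]
  refine ⟨LinearMap.finrank_range_of_inj hTi, fun z hz => ⟨T ⟨z, hz⟩, ⟨_, rfl⟩, ?_⟩, ?_⟩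
  · refine (hnear ⟨z, hz⟩).trans ?_
    have : ‖(⟨z, hz⟩ : Λ)‖ = ‖z‖ := rfl
    rw [this]
    nlinarith [norm_nonneg z]
  · rintro _ ⟨z, rfl⟩
    refine ⟨z, z.2, ?_⟩
    change ‖T z - z‖ ≤ ε * ‖T z‖
    have h1 := hnear z
    have h2 : ‖z‖ ≤ ‖T z‖ + ‖(z : G) - T z‖ := by
      have := norm_add_le (T z) ((z : G) - T z)
      rwa [add_sub_cancel] at this
    rw [norm_sub_rev]
    have h3 : δ * ‖z‖ ≤ 1 / 2 * ‖z‖ := mul_le_mul_of_nonneg_right hδ1 (norm_nonneg _)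
    have h4 : ‖z‖ ≤ 2 * ‖T z‖ := by linarith
    calc ‖(z : G) - T z‖ ≤ δ * (2 * ‖T z‖) := h1.trans (mul_le_mul_of_nonneg_left h4 hδ0.le)
      _ ≤ ε * ‖T z‖ := by nlinarith [norm_nonneg (T z)]

/-- A linear projection onto `Λ` is injective on subspaces all of whose vectors are close
to `Λ`. -/
theorem exists_finrank_le_of_near [FiniteDimensional ℝ G] (Λ : Submodule ℝ G) :
    ∃ ε > 0, ∀ Y : Submodule ℝ G,
      (∀ y ∈ Y, ∃ z ∈ Λ, ‖y - z‖ ≤ ε * ‖y‖) → finrank ℝ Y ≤ finrank ℝ Λ := by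
  obtain ⟨p, hp⟩ := Λ.subtype.exists_leftInverse_of_injective Λ.ker_subtype
  let P : G →L[ℝ] Λ := LinearMap.toContinuousLinearMap p
  have hP : ∀ z : Λ, P z = z := fun z => LinearMap.congr_fun hp z
  refine ⟨1 / (2 * (1 + ‖P‖)), by positivity, fun Y hY => ?_⟩
  refine LinearMap.finrank_le_finrank_of_injective (f := p ∘ₗ Y.subtype) ?_
  rw [← LinearMap.ker_eq_bot, LinearMap.ker_eq_bot']
  intro y hy
  obtain ⟨z, hz, hyz⟩ := hY y y.2
  have hPy : P y = 0 := hy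
  have h1 : P ((y : G) - z) = - ⟨z, hz⟩ := by rw [map_sub, hPy, hP ⟨z, hz⟩, zero_sub]
  have h2 : ‖z‖ ≤ ‖P‖ * ‖(y : G) - z‖ := by
    have := P.le_opNorm ((y : G) - z)
    rw [h1, norm_neg] at this
    exact this
  have h3 : ‖(y : G)‖ ≤ ‖(y : G) - z‖ + ‖z‖ := by
    simpa using norm_add_le ((y : G) - z) z
  have h4 : (1 + ‖P‖) * (1 / (2 * (1 + ‖P‖)) * ‖(y : G)‖) = ‖(y : G)‖ / 2 := by
    field_simp
  have h5 : ‖(y : G)‖ ≤ ‖(y : G)‖ / 2 := by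
    rw [← h4]
    nlinarith [norm_nonneg P, mul_le_mul_of_nonneg_left hyz (by positivity : 0 ≤ 1 + ‖P‖)]
  have : ‖(y : G)‖ = 0 := by linarith [norm_nonneg (y : G)]
  exact Subtype.ext (norm_eq_zero.1 this)

end Grassmann

/-! ### Lagrange planes of a linear map and a symmetric form -/

section Plane

variable {X : Type*} [AddCommGroup X] [Module ℝ X]
variable {B : Type*} [NormedAddCommGroup B] [NormedSpace ℝ B]

/-- The plane of all `(ξ, A v)` with `v ∈ W` and `ξ ∘ A + Q(v, ·) = 0` on `W`. -/
def lagrangePlane (A : X →ₗ[ℝ] B) (Q : X →ₗ[ℝ] X →ₗ[ℝ] ℝ) (W : Submodule ℝ X) :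
    Submodule ℝ (StrongDual ℝ B × B) where
  carrier := {z | ∃ v ∈ W, z.2 = A v ∧ ∀ w ∈ W, z.1 (A w) + Q v w = 0}
  zero_mem' := ⟨0, W.zero_mem, by simp, fun w _ => by simp⟩
  add_mem' := by
    rintro a b ⟨v, hv, hav, ha⟩ ⟨v', hv', hbv, hb⟩
    refine ⟨v + v', W.add_mem hv hv', by simp [hav, hbv], fun w hw => ?_⟩
    have h1 := ha w hw
    have h2 := hb w hw
    simp only [map_add, LinearMap.add_apply, Prod.fst_add, add_apply] at *
    linarith
  smul_mem' := by
    rintro c a ⟨v, hv, hav, ha⟩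
    refine ⟨c • v, W.smul_mem c hv, by simp [hav], fun w hw => ?_⟩
    have h1 := ha w hw
    simp only [map_smul, LinearMap.smul_apply, Prod.smul_fst, smul_apply, smul_eq_mul] at *
    linear_combination c * h1

variable {A : X →ₗ[ℝ] B} {Q : X →ₗ[ℝ] X →ₗ[ℝ] ℝ}

/-- A functional on `W` that vanishes on `W ∩ ker A` factors through `A`. -/
theorem exists_strongDual_comp_eq [FiniteDimensional ℝ B] (W : Submodule ℝ X) (f : X →ₗ[ℝ] ℝ)
    (hf : ∀ w ∈ W, A w = 0 → f w = 0) : ∃ η : StrongDual ℝ B, ∀ w ∈ W, η (A w) = f w := by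
  have h : f ∘ₗ W.subtype ∈ (A ∘ₗ W.subtype).dualMap.range := by
    rw [LinearMap.range_dualMap_eq_dualAnnihilator_ker, Submodule.mem_dualAnnihilator]
    intro w hw
    exact hf w w.2 hw
  obtain ⟨η, hη⟩ := h
  exact ⟨LinearMap.toContinuousLinearMap η, fun w hw => LinearMap.congr_fun hη ⟨w, hw⟩⟩

/-- Isotropy is the symmetry of `Q`. Conversely, a vector orthogonal to the plane gives a functional
on `B* × W` that vanishes on the solutions of the equation, so it factors through the equation map
`T`. The factor is an element of the bidual of `W`, that is, the required variation in `W`. -/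
theorem orthogonal_lagrangePlane (hQ : ∀ v w, Q v w = Q w v)
    (W : Submodule ℝ X) [FiniteDimensional ℝ W] :
    (sympForm B).orthogonal (lagrangePlane A Q W) = lagrangePlane A Q W := by
  refine le_antisymm (fun z hz => ?_) ?_
  · let T : (StrongDual ℝ B × W) →ₗ[ℝ] Dual ℝ W := LinearMap.coprod
      ((A ∘ₗ W.subtype).dualMap ∘ₗ (ContinuousLinearMap.coeLM ℝ))
      (W.subtype.dualMap ∘ₗ Q ∘ₗ W.subtype)
    have hT : ∀ a w, T a w = a.1 (A w) + Q a.2 w := fun a w => rfl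
    let f : Dual ℝ (StrongDual ℝ B × W) :=
      LinearMap.flip (sympForm B) z ∘ₗ LinearMap.id.prodMap (A ∘ₗ W.subtype)
    have hf : ∀ a, f a = a.1 z.2 - z.1 (A a.2) := fun a => rfl
    have h : f ∈ T.dualMap.range := by
      rw [LinearMap.range_dualMap_eq_dualAnnihilator_ker, Submodule.mem_dualAnnihilator]
      intro a ha
      refine hz (a.1, A a.2) ⟨a.2, a.2.2, rfl, fun w hw => ?_⟩
      have := LinearMap.congr_fun (LinearMap.mem_ker.1 ha) ⟨w, hw⟩
      exact this
    obtain ⟨φ, hφ⟩ := h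
    set v := (evalEquiv ℝ W).symm φ with hv
    have key : ∀ a : StrongDual ℝ B × W, a.1 (A v) + Q a.2 v = a.1 z.2 - z.1 (A a.2) := by
      intro a
      rw [← hT, ← hf, ← hφ, hv, apply_evalEquiv_symm_apply]
      rfl
    refine ⟨v, v.2, ?_, fun w hw => ?_⟩
    · refine (SeparatingDual.eq_iff_forall_dual_eq (R := ℝ)).2 fun g => ?_
      simpa using (key (g, 0)).symm
    · have := key (0, ⟨w, hw⟩)
      simp only [zero_apply, zero_add, zero_sub] at this
      rw [hQ, this]
      simp
  · rintro z ⟨v, hv, hzv, hz⟩ z' ⟨v', hv', hzv', hz'⟩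
    change z'.1 z.2 - z.1 z'.2 = 0
    rw [hzv, hzv']
    linarith [hz v' hv', hz' v hv, hQ v v']

theorem finrank_lagrangePlane [FiniteDimensional ℝ B] (hQ : ∀ v w, Q v w = Q w v)
    (W : Submodule ℝ X) [FiniteDimensional ℝ W] :
    finrank ℝ (lagrangePlane A Q W) = finrank ℝ B :=
  le_antisymm (finrank_le_of_isotropic (orthogonal_lagrangePlane hQ W).ge)
    (le_finrank_of_coisotropic (orthogonal_lagrangePlane hQ W).le)

end Plane

/-! ### Limits of Lagrangian subspaces -/

section Limit

variable {B : Type*} [NormedAddCommGroup B] [NormedSpace ℝ B] [FiniteDimensional ℝ B]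
variable {ι : Type*} {l : Filter ι} [l.NeBot]
variable {F : ι → Submodule ℝ (StrongDual ℝ B × B)} {Λ : Submodule ℝ (StrongDual ℝ B × B)}

/-- A limit of Lagrangian subspaces is Lagrangian. -/
theorem orthogonal_eq_of_tendsto (hF : ∀ i, (sympForm B).orthogonal (F i) = F i)
    (h : Tendsto F l (grassmannNhds Λ)) : (sympForm B).orthogonal Λ = Λ := by
  refine orthogonal_eq_of_isotropic (fun z hz z' hz' => ?_) ?_
  · change sympForm B z' z = 0
    by_contra hne
    have hpos : 0 < |sympForm B z' z| := abs_pos.2 hne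
    set c := 2 * ‖z'‖ * ‖z‖ with hc
    have hc0 : 0 ≤ c := by positivity
    -- Replacing `z'` and `z` by approximations in an isotropic `F i` leaves three error terms, each
    -- at most `ε * c`.
    obtain ⟨ε, hε, hε1, hεc⟩ : ∃ ε : ℝ, 0 < ε ∧ ε ≤ 1 ∧ 3 * ε * c < |sympForm B z' z| := by
      refine ⟨min 1 (|sympForm B z' z| / (3 * c + 1) / 2), by positivity, min_le_left _ _, ?_⟩
      have h1 : min 1 (|sympForm B z' z| / (3 * c + 1) / 2) ≤
        |sympForm B z' z| / (3 * c + 1) / 2 := min_le_right _ _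
      have h2 : |sympForm B z' z| / (3 * c + 1) * (3 * c + 1) = |sympForm B z' z| := by
        field_simp
      have h3 : 0 ≤ |sympForm B z' z| / (3 * c + 1) := by positivity
      nlinarith
    obtain ⟨i, -, hi, -⟩ := (eventually_near_of_tendsto_grassmannNhds h hε).exists
    obtain ⟨y, hy, hyz⟩ := hi z hz
    obtain ⟨y', hy', hyz'⟩ := hi z' hz'
    have h0 : sympForm B y' y = 0 := ((hF i).ge hy) y' hy'
    have hsplit : sympForm B z' z = sympForm B (z' - y') z + sympForm B z' (z - y)
        - sympForm B (z' - y') (z - y) := by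
      simp only [map_sub, LinearMap.sub_apply, h0]
      ring
    have e1 := abs_sympForm_le (z' - y') z
    have e2 := abs_sympForm_le z' (z - y)
    have e3 := abs_sympForm_le (z' - y') (z - y)
    have n1 := norm_nonneg z
    have n2 := norm_nonneg z'
    have m1 : 2 * ‖z' - y'‖ * ‖z‖ ≤ ε * c := by nlinarith
    have m2 : 2 * ‖z'‖ * ‖z - y‖ ≤ ε * c := by nlinarith
    have m3 : 2 * ‖z' - y'‖ * ‖z - y‖ ≤ ε * c := by
      have : ‖z' - y'‖ * ‖z - y‖ ≤ (ε * ‖z'‖) * (ε * ‖z‖) :=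
        mul_le_mul hyz' hyz (norm_nonneg _) (by positivity)
      have h4 : ε * (ε * (‖z'‖ * ‖z‖)) ≤ 1 * (ε * (‖z'‖ * ‖z‖)) :=
        mul_le_mul_of_nonneg_right hε1 (by positivity)
      rw [hc]
      linarith
    have := abs_sub (sympForm B (z' - y') z + sympForm B z' (z - y))
      (sympForm B (z' - y') (z - y))
    have := abs_add_le (sympForm B (z' - y') z) (sympForm B z' (z - y))
    rw [← hsplit] at *
    linarith
  · obtain ⟨i, hi, -⟩ := (eventually_near_of_tendsto_grassmannNhds h one_pos).exists
    rw [← hi]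
    exact le_finrank_of_coisotropic (hF i).le

end Limit

/-! ### Symplectic reduction by `S^⊥ × S` -/

section Reduction

variable {B : Type*} [NormedAddCommGroup B] [NormedSpace ℝ B]
variable {B' : Type*} [NormedAddCommGroup B'] [NormedSpace ℝ B']

@[simp] theorem proj₀_fst_apply (z : StrongDual ℝ (B × B') × (B × B')) (x : B) :
    (proj₀ z).1 x = z.1 (x, 0) := rfl

@[simp] theorem proj₀_snd (z : StrongDual ℝ (B × B') × (B × B')) : (proj₀ z).2 = z.2.1 := rfl

@[simp] theorem proj₁_fst_apply (z : StrongDual ℝ (B × B') × (B × B')) (x : B') :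
    (proj₁ z).1 x = z.1 (0, x) := rfl

@[simp] theorem proj₁_snd (z : StrongDual ℝ (B × B') × (B × B')) : (proj₁ z).2 = z.2.2 := rfl

@[simp] theorem proj₀_coprod (ξ : StrongDual ℝ B) (η : StrongDual ℝ B') (x : B × B') :
    proj₀ (ξ.coprod η, x) = (ξ, x.1) := by
  refine Prod.ext ?_ rfl
  ext y
  simp

@[simp] theorem proj₁_coprod (ξ : StrongDual ℝ B) (η : StrongDual ℝ B') (x : B × B') :
    proj₁ (ξ.coprod η, x) = (η, x.2) := by
  refine Prod.ext ?_ rfl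
  ext y
  simp

theorem mem_reduction {S : Submodule ℝ B} {Λ : Submodule ℝ (StrongDual ℝ (B × B') × (B × B'))}
    {z : StrongDual ℝ B' × B'} :
    z ∈ (Λ ⊓ (annihilatorProd S).comap proj₀).map proj₁ ↔
      ∃ ξ : StrongDual ℝ B, ∃ x ∈ S, (∀ s ∈ S, ξ s = 0) ∧ (ξ.coprod z.1, (x, z.2)) ∈ Λ := by
  constructor
  · rintro ⟨y, ⟨hy, hy'⟩, rfl⟩
    refine ⟨y.1.comp (ContinuousLinearMap.inl ℝ B B'), y.2.1, hy'.2, hy'.1, ?_⟩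
    have : y = ((y.1.comp (ContinuousLinearMap.inl ℝ B B')).coprod (proj₁ y).1, y.2) := by
      refine Prod.ext ?_ rfl
      ext x <;> simp
    rw [this] at hy
    exact hy
  · rintro ⟨ξ, x, hx, hξ, h⟩
    refine ⟨_, ⟨h, ?_⟩, proj₁_coprod _ _ _⟩
    change proj₀ (ξ.coprod z.1, (x, z.2)) ∈ annihilatorProd S
    rw [proj₀_coprod]
    exact ⟨hξ, hx⟩

/-- The annihilator plane contains its symplectic orthogonal. -/
theorem mem_annihilatorProd_of_forall [FiniteDimensional ℝ B] {S : Submodule ℝ B}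
    {z : StrongDual ℝ B × B}
    (hz : ∀ y ∈ annihilatorProd S, sympForm B y z = 0) : z ∈ annihilatorProd S := by
  refine ⟨fun s hs => ?_, ?_⟩
  · simpa using hz (0, s) ⟨fun _ _ => rfl, hs⟩
  · by_contra hne
    obtain ⟨f, hf, hfS⟩ := S.exists_dual_map_eq_bot_of_notMem hne inferInstance
    refine hf ?_
    have := hz (LinearMap.toContinuousLinearMap f, 0) ⟨fun s hs => ?_, S.zero_mem⟩
    · simpa using this
    · have h1 : f s ∈ S.map f := Submodule.mem_map_of_mem hs
      rw [hfS] at h1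
      simpa using h1

/-- The reduction of a Lagrangian subspace is coisotropic. -/
theorem orthogonal_reduction_le [FiniteDimensional ℝ B] [FiniteDimensional ℝ B']
    (S : Submodule ℝ B) {Λ : Submodule ℝ (StrongDual ℝ (B × B') × (B × B'))}
    (hΛ : (sympForm (B × B')).orthogonal Λ = Λ) :
    (sympForm B').orthogonal ((Λ ⊓ (annihilatorProd S).comap proj₀).map proj₁) ≤
      (Λ ⊓ (annihilatorProd S).comap proj₀).map proj₁ := by
  intro y hy
  let P : Submodule ℝ (StrongDual ℝ (B × B') × (B × B')) :=
    { carrier := {z | proj₀ z ∈ annihilatorProd S ∧ proj₁ z = 0}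
      zero_mem' := ⟨by simp, by simp⟩
      add_mem' := fun ha hb => ⟨by
        rw [map_add]; exact add_mem ha.1 hb.1, by rw [map_add, ha.2, hb.2, add_zero]⟩
      smul_mem' := fun c _ ha => ⟨by
        rw [map_smul]; exact Submodule.smul_mem _ _ ha.1, by rw [map_smul, ha.2, smul_zero]⟩ }
  have hsplit : ∀ a b : StrongDual ℝ (B × B') × (B × B'), sympForm (B × B') a b =
      sympForm B (proj₀ a) (proj₀ b) + sympForm B' (proj₁ a) (proj₁ b) := by
    intro a b
    have h1 : ∀ (ξ : StrongDual ℝ (B × B')) (x : B × B'), ξ x = ξ (x.1, 0) + ξ (0, x.2) := by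
      intro ξ x
      rw [← map_add]
      simp
    simp only [sympForm_apply]
    rw [h1 a.1 b.2, h1 b.1 a.2]
    simp only [proj₀_fst_apply, proj₁_fst_apply, proj₀_snd, proj₁_snd]
    ring
  let Y : StrongDual ℝ (B × B') × (B × B') := ((0 : StrongDual ℝ B).coprod y.1, (0, y.2))
  have hY0 : proj₀ Y = 0 := proj₀_coprod _ _ _
  have hY1 : proj₁ Y = y := proj₁_coprod _ _ _
  -- By double orthogonality it is enough to pair `Y` with `(Λ ⊔ P)^⊥`. This lies in `Λ` and, as
  -- `S^⊥ × S` is coisotropic, over `S^⊥ × S`; so its projection by `π₁` lies in the reduction, to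
  -- which `y` is orthogonal.
  have hYmem : Y ∈ Λ ⊔ P := by
    refine (orthogonal_orthogonal_sympForm (Λ ⊔ P)).le fun a ha => ?_
    have ha1 : a ∈ Λ := by
      rw [← hΛ]
      exact fun b hb => ha b (Submodule.mem_sup_left hb)
    have ha0 : proj₀ a ∈ annihilatorProd S := mem_annihilatorProd_of_forall fun b hb => by
      have hbP : ((b.1.coprod 0, (b.2, 0)) : StrongDual ℝ (B × B') × (B × B')) ∈ P := by
        refine ⟨?_, proj₁_coprod _ _ _⟩
        rw [proj₀_coprod]
        exact hb
      have h0 : sympForm (B × B') _ a = 0 := ha _ (Submodule.mem_sup_right hbP)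
      rwa [hsplit, proj₀_coprod, proj₁_coprod, Prod.mk_zero_zero, map_zero, LinearMap.zero_apply,
        add_zero] at h0
    change sympForm (B × B') a Y = 0
    rw [hsplit, hY0, hY1, map_zero, zero_add]
    exact hy _ ⟨a, ⟨ha1, ha0⟩, rfl⟩
  obtain ⟨z, hz, p, hp, hzp⟩ := Submodule.mem_sup.1 hYmem
  refine ⟨z, ⟨hz, ?_⟩, ?_⟩
  · have h1 : proj₀ z = - proj₀ p := by
      rw [eq_neg_iff_add_eq_zero, ← map_add, hzp, hY0]
    change proj₀ z ∈ annihilatorProd S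
    rw [h1]
    exact neg_mem hp.1
  · rw [← hY1, ← hzp, map_add, hp.2, add_zero]

end Reduction

/-! ### Removing a finite-rank error term from a seminorm estimate -/

section Seminorm

variable {V : Type*} [AddCommGroup V] [Module ℝ V]
variable {F : Type*} [NormedAddCommGroup F] [NormedSpace ℝ F]

/-- In a finite-dimensional space of functionals the norm controls the bounds with respect to a
seminorm, for those functionals that are bounded. -/
theorem exists_bound_of_finiteDimensional {G : Type*} [NormedAddCommGroup G] [NormedSpace ℝ G]
    [FiniteDimensional ℝ G] (ρ : Seminorm ℝ V) (T : G →ₗ[ℝ] V →ₗ[ℝ] ℝ) :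
    ∃ C, 0 ≤ C ∧ ∀ θ, (∃ K, ∀ w, |T θ w| ≤ K * ρ w) → ∀ w, |T θ w| ≤ C * ‖θ‖ * ρ w := by
  let F₁ : Submodule ℝ G :=
    { carrier := {θ | ∃ K, ∀ w, |T θ w| ≤ K * ρ w}
      zero_mem' := ⟨0, fun w => by simp⟩
      add_mem' := by
        rintro a b ⟨K, hK⟩ ⟨L, hL⟩
        refine ⟨K + L, fun w => ?_⟩
        rw [map_add, LinearMap.add_apply, add_mul]
        exact (abs_add_le _ _).trans (add_le_add (hK w) (hL w))
      smul_mem' := by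
        rintro c a ⟨K, hK⟩
        refine ⟨|c| * K, fun w => ?_⟩
        rw [map_smul, LinearMap.smul_apply, smul_eq_mul, abs_mul, mul_assoc]
        exact mul_le_mul_of_nonneg_left (hK w) (abs_nonneg c) }
  let b := finBasis ℝ F₁
  have hb : ∀ i, ∃ K, ∀ w, |T (b i) w| ≤ K * ρ w := fun i => (b i).2
  choose K hK using hb
  obtain ⟨C, hC, hCb⟩ := b.exists_opNorm_le (F := ℝ)
  set L := ∑ i, |K i| with hL
  have hL0 : 0 ≤ L := Finset.sum_nonneg fun i _ => abs_nonneg _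
  refine ⟨C * L, by positivity, fun θ hθ w => ?_⟩
  let e : F₁ →L[ℝ] ℝ := LinearMap.toContinuousLinearMap (LinearMap.flip T w ∘ₗ F₁.subtype)
  have h : ‖e‖ ≤ C * (L * ρ w) := hCb (mul_nonneg hL0 (apply_nonneg ρ w)) fun i => by
    refine (hK i w).trans (mul_le_mul_of_nonneg_right ?_ (apply_nonneg ρ w))
    exact (le_abs_self _).trans
      (Finset.single_le_sum (f := fun i => |K i|) (fun i _ => abs_nonneg _) (Finset.mem_univ i))
  calc |T θ w| ≤ ‖e‖ * ‖θ‖ := e.le_opNorm ⟨θ, hθ⟩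
    _ ≤ C * (L * ρ w) * ‖θ‖ := mul_le_mul_of_nonneg_right h (norm_nonneg _)
    _ = C * L * ‖θ‖ * ρ w := by ring

/-- A functional that is bounded by a seminorm `ρ` and is small with respect to `ρ + ‖Θ ·‖`,
where `Θ` takes values in a finite-dimensional space, is small with respect to `ρ`. -/
theorem exists_bound_of_le_add_norm [FiniteDimensional ℝ F] (ρ : Seminorm ℝ V) (Θ : V →ₗ[ℝ] F) :
    ∃ C, 0 ≤ C ∧ ∀ (q : V →ₗ[ℝ] ℝ) (ε : ℝ), 0 ≤ ε → (∃ K, ∀ w, |q w| ≤ K * ρ w) →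
      (∀ w, |q w| ≤ ε * (ρ w + ‖Θ w‖)) → ∀ w, |q w| ≤ C * ε * ρ w := by
  let T : StrongDual ℝ F →ₗ[ℝ] V →ₗ[ℝ] ℝ :=
    LinearMap.lcomp ℝ ℝ Θ ∘ₗ ContinuousLinearMap.coeLM ℝ
  have hTa : ∀ θ w, T θ w = θ (Θ w) := fun _ _ => rfl
  obtain ⟨C, hC, hCb⟩ := exists_bound_of_finiteDimensional ρ T
  refine ⟨1 + C, by positivity, fun q ε hε ⟨K', hK'⟩ hq => ?_⟩
  -- Hahn–Banach from the graph of `Θ` to `V × F` splits `q` into a part bounded by `ε ρ` and a part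
  -- `θ ∘ Θ` with `‖θ‖ ≤ ε`. The second part is `ρ`-bounded as a difference, and finite dimension
  -- makes that bound proportional to `‖θ‖`. So `K` does not enter `C`.
  obtain ⟨g, hg, hgN⟩ := exists_extension_of_le_sublinear
    (⟨Θ.graph, q ∘ₗ LinearMap.fst ℝ V F ∘ₗ Θ.graph.subtype⟩ : V × F →ₗ.[ℝ] ℝ)
    (fun x => ε * (ρ x.1 + ‖x.2‖))
    (fun c hc x => by
      simp only [Prod.smul_fst, Prod.smul_snd, map_smul_eq_mul, norm_smul, Real.norm_eq_abs,
        abs_of_pos hc]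
      ring)
    (fun x y => by
      have h1 := map_add_le_add ρ x.1 y.1
      have h2 := norm_add_le x.2 y.2
      simp only [Prod.fst_add, Prod.snd_add]
      nlinarith)
    (fun x => by
      obtain ⟨⟨w, y⟩, hx⟩ := x
      obtain rfl : y = Θ w := hx
      exact (le_abs_self _).trans (hq w))
  have hgraph : ∀ w, g (w, 0) + g (0, Θ w) = q w := fun w => by
    rw [← map_add]
    simpa using hg ⟨(w, Θ w), rfl⟩
  have hg1 : ∀ w, |g (w, 0)| ≤ ε * ρ w := fun w => by
    refine abs_le'.2 ⟨by simpa using hgN (w, 0), ?_⟩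
    have := hgN (-w, 0)
    have h2 : g (-w, 0) = - g (w, 0) := by
      rw [← map_neg]
      simp
    simpa [h2] using this
  have hg2 : ∀ y, ‖g (0, y)‖ ≤ ε * ‖y‖ := fun y => by
    refine abs_le'.2 ⟨by simpa using hgN (0, y), ?_⟩
    have := hgN (0, -y)
    have h2 : g (0, -y) = - g (0, y) := by
      rw [← map_neg]
      simp
    simpa [h2] using this
  let θ : StrongDual ℝ F := (g ∘ₗ LinearMap.inr ℝ V F).mkContinuous ε hg2
  have hθn : ‖θ‖ ≤ ε := LinearMap.mkContinuous_norm_le _ hε _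
  have hθ : ∀ w, |T θ w| ≤ (K' + ε) * ρ w := fun w => by
    have h1 : T θ w = q w - g (w, 0) := by
      rw [← hgraph w, add_sub_cancel_left]
      rfl
    rw [h1, add_mul]
    exact (abs_sub _ _).trans (add_le_add (hK' w) (hg1 w))
  intro w
  have h1 := hCb θ ⟨_, hθ⟩ w
  have h2 : q w = g (w, 0) + T θ w := (hgraph w).symm
  have h3 : C * ‖θ‖ * ρ w ≤ C * ε * ρ w := mul_le_mul_of_nonneg_right
    (mul_le_mul_of_nonneg_left hθn hC) (apply_nonneg ρ w)
  have h4 := (abs_add_le (g (w, 0)) (T θ w)).trans (add_le_add (hg1 w) (h1.trans h3))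
  rw [h2]
  linarith

end Seminorm

/-! ### Index of a symmetric form and the associated seminorm -/

section Index

variable {V : Type*} [AddCommGroup V] [Module ℝ V]

/-- `N` is finite-dimensional and `b` is negative definite on `N`. -/
def IsNegDefOn (b : V →ₗ[ℝ] V →ₗ[ℝ] ℝ) (N : Submodule ℝ V) : Prop :=
  FiniteDimensional ℝ N ∧ ∀ v ∈ N, v ≠ 0 → b v v < 0

/-- Either there is a maximal negative definite subspace, or there are negative definite
subspaces of arbitrarily large dimensions. -/
theorem exists_maximal_isNegDefOn_or {b : V →ₗ[ℝ] V →ₗ[ℝ] ℝ} (hb : ∀ v w, b v w = b w v) :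
    (∃ N, IsNegDefOn b N ∧ ∀ v, (∀ n ∈ N, b v n = 0) → 0 ≤ b v v) ∨
      ∀ n : ℕ, ∃ N, IsNegDefOn b N ∧ n < finrank ℝ N := by
  by_cases h : ∀ n : ℕ, ∃ N, IsNegDefOn b N ∧ n < finrank ℝ N
  · exact Or.inr h
  left
  push Not at h
  obtain ⟨n, hn⟩ := h
  have hbdd : BddAbove {m | ∃ N, IsNegDefOn b N ∧ finrank ℝ N = m} :=
    ⟨n, by rintro _ ⟨N, hN, rfl⟩; exact hn N hN⟩
  have hne : {m | ∃ N, IsNegDefOn b N ∧ finrank ℝ N = m}.Nonempty :=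
    ⟨_, ⊥, ⟨inferInstance, fun v hv h0 => absurd ((Submodule.mem_bot ℝ).1 hv) h0⟩, rfl⟩
  obtain ⟨N, hN, hNm⟩ := Nat.sSup_mem hne hbdd
  refine ⟨N, hN, fun v hv => ?_⟩
  by_contra hlt
  push Not at hlt
  have := hN.1
  have hneg : IsNegDefOn b (N ⊔ ℝ ∙ v) := by
    refine ⟨inferInstance, fun x hx hx0 => ?_⟩
    obtain ⟨n, hnN, y, hy, rfl⟩ := Submodule.mem_sup.1 hx
    obtain ⟨c, rfl⟩ := Submodule.mem_span_singleton.1 hy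
    have h1 : b (n + c • v) (n + c • v) = b n n + c ^ 2 * b v v := by
      simp only [map_add, map_smul, LinearMap.add_apply, LinearMap.smul_apply, smul_eq_mul,
        hb n v, hv n hnN]
      ring
    rw [h1]
    by_cases hn0 : n = 0
    · have hc : c ≠ 0 := by
        rintro rfl
        simp [hn0] at hx0
      have : 0 < c ^ 2 := by positivity
      have h2 : b n n = 0 := by simp [hn0]
      linarith [mul_neg_of_pos_of_neg this hlt]
    · have := hN.2 n hnN hn0
      nlinarith [sq_nonneg c]
  have hvN : v ∉ N := fun hvN => (hv v hvN).not_lt hlt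
  have h1 : finrank ℝ N < finrank ℝ (N ⊔ ℝ ∙ v : Submodule ℝ V) := by
    refine Submodule.finrank_lt_finrank_of_lt (lt_of_le_of_ne le_sup_left fun heq => hvN ?_)
    rw [heq]
    exact Submodule.mem_sup_right (Submodule.mem_span_singleton_self v)
  have h2 := le_csSup hbdd ⟨_, hneg, rfl⟩
  omega

/-- A negative definite subspace of dimension above that of `F` meets the kernel of `Θ`. Infinite
index thus survives finitely many linear conditions. -/
theorem exists_neg_of_finrank_lt {b : V →ₗ[ℝ] V →ₗ[ℝ] ℝ} {F : Type*} [AddCommGroup F] [Module ℝ F]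
    [FiniteDimensional ℝ F] (h : ∀ n : ℕ, ∃ N, IsNegDefOn b N ∧ n < finrank ℝ N)
    (Θ : V →ₗ[ℝ] F) : ∃ z, Θ z = 0 ∧ b z z < 0 := by
  obtain ⟨N, hN, hlt⟩ := h (finrank ℝ F)
  have := hN.1
  have hker : (Θ ∘ₗ N.subtype).ker ≠ ⊥ := fun hbot =>
    (LinearMap.finrank_le_finrank_of_injective (LinearMap.ker_eq_bot.1 hbot)).not_gt hlt
  obtain ⟨z, hz, hz0⟩ := Submodule.exists_mem_ne_zero_of_ne_bot hker
  exact ⟨z, hz, hN.2 z z.2 fun h0 => hz0 (Subtype.ext h0)⟩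

theorem sq_le_of_nonneg {G : V →ₗ[ℝ] V →ₗ[ℝ] ℝ} (hG : ∀ v w, G v w = G w v)
    (hpos : ∀ v, 0 ≤ G v v) (v w : V) : (G v w) ^ 2 ≤ G v v * G w w := by
  have h := discrim_le_zero (a := G w w) (b := 2 * G v w) (c := G v v) fun t => by
    have := hpos (v + t • w)
    simp only [map_add, map_smul, LinearMap.add_apply, LinearMap.smul_apply, smul_eq_mul,
      hG w v] at this
    linarith
  rw [discrim] at h
  linarith

/-- The seminorm of a nonnegative symmetric form. -/
theorem exists_seminorm_of_nonneg {G : V →ₗ[ℝ] V →ₗ[ℝ] ℝ} (hG : ∀ v w, G v w = G w v)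
    (hpos : ∀ v, 0 ≤ G v v) :
    ∃ g : Seminorm ℝ V, (∀ v, g v ^ 2 = G v v) ∧ ∀ v w, |G v w| ≤ g v * g w := by
  have hcs : ∀ v w, |G v w| ≤ √(G v v) * √(G w w) := fun v w => by
    rw [← Real.sqrt_mul (hpos v)]
    exact Real.abs_le_sqrt (sq_le_of_nonneg hG hpos v w)
  refine ⟨Seminorm.of (fun v => √(G v v)) (fun v w => ?_) (fun c v => ?_),
    fun v => Real.sq_sqrt (hpos v), hcs⟩
  · refine (Real.sqrt_le_left (by positivity)).2 ?_
    simp only [map_add, LinearMap.add_apply, hG w v]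
    have h1 := Real.sq_sqrt (hpos v)
    have h2 := Real.sq_sqrt (hpos w)
    have h3 := (le_abs_self _).trans (hcs v w)
    nlinarith
  · simp only [map_smul, LinearMap.smul_apply, smul_eq_mul]
    rw [← mul_assoc, Real.sqrt_mul (mul_self_nonneg c), Real.sqrt_mul_self_eq_abs]
    rfl

/-- The norm of the Hilbert space structure that turns a form `b` with a maximal negative definite
subspace `N` into the difference of the squares of the norms of the two components. -/
theorem exists_seminorm_of_maximal {b : V →ₗ[ℝ] V →ₗ[ℝ] ℝ} (hb : ∀ v w, b v w = b w v)
    {N : Submodule ℝ V} (hN : IsNegDefOn b N) (hmax : ∀ v, (∀ n ∈ N, b v n = 0) → 0 ≤ b v v)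
    {F : Type*} [NormedAddCommGroup F] [NormedSpace ℝ F] (Φ : V →ₗ[ℝ] F) :
    ∃ (g : Seminorm ℝ V) (P : V →ₗ[ℝ] V) (C : ℝ), 0 ≤ C ∧ (∀ v, P v ∈ N) ∧
      (∀ v, g v ^ 2 = b v (v - (2 : ℝ) • P v)) ∧ (∀ v w, |b v w| ≤ g v * g w) ∧
      ∀ v, ‖Φ (P v)‖ ≤ C * g v := by
  have := hN.1
  let β : LinearMap.BilinForm ℝ N := b.domRestrict₁₂ N N
  have hβ : β.Nondegenerate := by
    have key : ∀ n : N, β n n = 0 → n = 0 := fun n hn => by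
      by_contra hne
      exact (hN.2 n n.2 fun h0 => hne (Subtype.ext h0)).ne hn
    exact ⟨fun n hn => key n (hn n), fun n hn => key n (hn n)⟩
  -- The `b`-orthogonal projection onto `N`. The form `G` below flips the sign of `b` on `N`, and
  -- maximality of `N` makes it nonnegative.
  let P₀ : V →ₗ[ℝ] N := (β.toDual hβ).symm.toLinearMap ∘ₗ N.subtype.dualMap ∘ₗ b
  have hP₀ : ∀ v (n : N), b (P₀ v) n = b v n := fun v n =>
    LinearMap.BilinForm.apply_toDual_symm_apply (hB := hβ) (b v ∘ₗ N.subtype) n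
  let P : V →ₗ[ℝ] V := N.subtype ∘ₗ P₀
  have hPN : ∀ v, P v ∈ N := fun v => (P₀ v).2
  have hP : ∀ v, ∀ n ∈ N, b (P v) n = b v n := fun v n hn => hP₀ v ⟨n, hn⟩
  have hPP : ∀ v, P (P v) = P v := fun v => by
    refine congrArg Subtype.val (?_ : P₀ (P v) = P₀ v)
    refine (β.toDual hβ).injective (LinearMap.ext fun n => ?_)
    change b (P₀ (P v)) n = b (P₀ v) n
    rw [hP₀]
    rfl
  let G : V →ₗ[ℝ] V →ₗ[ℝ] ℝ := b - (2 : ℝ) • b.compl₁₂ P P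
  have hGa : ∀ v w, G v w = b v w - 2 * b (P v) (P w) := fun v w => rfl
  have hGs : ∀ v w, G v w = G w v := fun v w => by rw [hGa, hGa, hb v w, hb (P v)]
  have hGp : ∀ v, 0 ≤ G v v := fun v => by
    have h1 : 0 ≤ b (v - P v) (v - P v) := hmax _ fun n hn => by
      rw [map_sub, LinearMap.sub_apply, hP v n hn, sub_self]
    have h2 : b (P v) (P v) ≤ 0 := by
      by_cases h0 : P v = 0
      · simp [h0]
      · exact (hN.2 _ (hPN v) h0).le
    have h3 : b (v - P v) (v - P v) = b v v - b (P v) (P v) := by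
      have h4 := hP v _ (hPN v)
      simp only [map_sub, LinearMap.sub_apply, hb (P v) v] at *
      linarith
    rw [hGa]
    linarith
  obtain ⟨g, hg, hgG⟩ := exists_seminorm_of_nonneg hGs hGp
  have hbG : ∀ v w, G v (w - (2 : ℝ) • P w) = b v w := fun v w => by
    have := hP v _ (hPN w)
    simp only [hGa, map_sub, map_smul, hPP, smul_eq_mul]
    linarith
  -- The reflection `1 - 2P` is an isometry of `g` and turns `G` into `b`, so the Cauchy–Schwarz
  -- inequality for `G` passes to `b`.
  have hrefl : ∀ w, g (w - (2 : ℝ) • P w) = g w := fun w => by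
    have h1 : g (w - (2 : ℝ) • P w) ^ 2 = g w ^ 2 := by
      have h2 : w - (2 : ℝ) • P w - (2 : ℝ) • P (w - (2 : ℝ) • P w) = w := by
        simp only [map_sub, map_smul, hPP]
        module
      rw [hg, hg, hbG, hb, ← hbG, h2]
    exact (sq_eq_sq₀ (apply_nonneg g _) (apply_nonneg g _)).1 h1
  have hbg : ∀ v w, |b v w| ≤ g v * g w := fun v w => by
    rw [← hbG, ← hrefl w]
    exact hgG _ _
  let e := finBasis ℝ N
  -- The dual basis with respect to `b`: the coordinates of `P v` are `b (d i) v`, which `g`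
  -- controls.
  let d : Fin (finrank ℝ N) → N := fun i => (β.toDual hβ).symm (e.coord i)
  have hd : ∀ i v, e.repr (P₀ v) i = b (d i) v := fun i v => by
    have h1 : b (d i) (P₀ v) = e.coord i (P₀ v) :=
      LinearMap.BilinForm.apply_toDual_symm_apply (hB := hβ) (e.coord i) (P₀ v)
    rw [hb (d i) v, ← hP₀ v (d i), hb, h1]
    rfl
  refine ⟨g, P, ∑ i, g (d i) * ‖Φ (e i)‖, Finset.sum_nonneg fun i _ => by positivity, hPN,
    fun v => ?_, hbg, fun v => ?_⟩
  · have := hP v _ (hPN v)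
    rw [hg, hGa, map_sub, map_smul, smul_eq_mul, this]
  · have h1 : Φ (P v) = ∑ i, b (d i) v • Φ (e i) := by
      have : P v = ∑ i, b (d i) v • (e i : V) := by
        change (P₀ v : V) = _
        conv_lhs => rw [← e.sum_repr (P₀ v)]
        simp [hd]
      rw [this]
      simp
    rw [h1, Finset.sum_mul]
    refine (norm_sum_le _ _).trans (Finset.sum_le_sum fun i _ => ?_)
    rw [norm_smul, Real.norm_eq_abs]
    have := hbg (d i) v
    nlinarith [norm_nonneg (Φ (e i))]

end Index

/-! ### Directedness of the finite-dimensional subspaces -/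

section Directed

variable {X : Type*} [AddCommGroup X] [Module ℝ X]

instance {V : Submodule ℝ X} : Nonempty (FinDimSub V) := ⟨⟨⊥, bot_le, inferInstance⟩⟩

instance {V : Submodule ℝ X} : IsDirectedOrder (FinDimSub V) := ⟨fun W W' => by
  have := W.2.2
  have := W'.2.2
  exact ⟨⟨W.1 ⊔ W'.1, sup_le W.2.1 W'.2.1, inferInstance⟩, le_sup_left (a := W.1),
    le_sup_right (a := W.1)⟩⟩

end Directed

/-! ### Both indices infinite: rigidity of convergent Lagrange planes -/

section Indefinite

variable {X : Type*} [AddCommGroup X] [Module ℝ X]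
variable {B : Type*} [NormedAddCommGroup B] [NormedSpace ℝ B]
variable {A : X →ₗ[ℝ] B} {Q : X →ₗ[ℝ] X →ₗ[ℝ] ℝ}

/-- A functional on `K` that vanishes on the orthogonal complement of a finite-dimensional space
`U` is represented by an element of `U`. -/
theorem exists_mem_forall_eq (Q : X →ₗ[ℝ] X →ₗ[ℝ] ℝ) (U K : Submodule ℝ X)
    [FiniteDimensional ℝ U] (f : X →ₗ[ℝ] ℝ)
    (h : ∀ w ∈ K, (∀ u ∈ U, Q u w = 0) → f w = 0) : ∃ u ∈ U, ∀ w ∈ K, Q u w = f w := by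
  let R : K →ₗ[ℝ] Dual ℝ U := U.subtype.dualMap ∘ₗ LinearMap.flip Q ∘ₗ K.subtype
  have hf : f ∘ₗ K.subtype ∈ R.dualMap.range := by
    rw [LinearMap.range_dualMap_eq_dualAnnihilator_ker, Submodule.mem_dualAnnihilator]
    intro w hw
    exact h w w.2 fun u hu => LinearMap.congr_fun (LinearMap.mem_ker.1 hw) ⟨u, hu⟩
  obtain ⟨φ, hφ⟩ := hf
  refine ⟨(evalEquiv ℝ U).symm φ, Subtype.mem _, fun w hw => ?_⟩
  have h1 : R ⟨w, hw⟩ ((evalEquiv ℝ U).symm φ) = φ (R ⟨w, hw⟩) := apply_evalEquiv_symm_apply _ _ _ _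
  exact h1.trans (LinearMap.congr_fun hφ ⟨w, hw⟩)

/-- The radical of the restriction of `Q` to `W ∩ ker A`. -/
def kerRadical (A : X →ₗ[ℝ] B) (Q : X →ₗ[ℝ] X →ₗ[ℝ] ℝ) (W : Submodule ℝ X) : Submodule ℝ X where
  carrier := {k | k ∈ W ∧ A k = 0 ∧ ∀ u ∈ W, A u = 0 → Q k u = 0}
  zero_mem' := ⟨W.zero_mem, map_zero A, fun u _ _ => by simp⟩
  add_mem' := fun ⟨h1, h2, h3⟩ ⟨h1', h2', h3'⟩ => ⟨W.add_mem h1 h1', by rw [map_add, h2, h2', add_zero],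
    fun u hu hu0 => by rw [map_add, LinearMap.add_apply, h3 u hu hu0, h3' u hu hu0, add_zero]⟩
  smul_mem' := fun c _ ⟨h1, h2, h3⟩ => ⟨W.smul_mem c h1, by rw [map_smul, h2, smul_zero],
    fun u hu hu0 => by rw [map_smul, LinearMap.smul_apply, h3 u hu hu0, smul_zero]⟩

theorem kerRadical_le (A : X →ₗ[ℝ] B) (Q : X →ₗ[ℝ] X →ₗ[ℝ] ℝ) (W : Submodule ℝ X) :
    kerRadical A Q W ≤ W := fun _ h => h.1

/-- Every finite-dimensional space can be enlarged so that `Q` has no radical on its intersection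
with `ker A`, apart from the radical of `Q` on `ker A`. -/
theorem exists_le_kerRadical_orthogonal (A : X →ₗ[ℝ] B) (hQ : ∀ v w, Q v w = Q w v)
    (W₀ : Submodule ℝ X)
    [FiniteDimensional ℝ W₀] : ∃ W, W₀ ≤ W ∧ FiniteDimensional ℝ W ∧
      ∀ k ∈ kerRadical A Q W, ∀ w, A w = 0 → Q k w = 0 := by
  have hne : {m | ∃ W, W₀ ≤ W ∧ FiniteDimensional ℝ W ∧
      finrank ℝ (kerRadical A Q W) = m}.Nonempty := ⟨_, W₀, le_rfl, inferInstance, rfl⟩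
  -- Choose `W` with radical of least dimension. If some `k` in the radical were not orthogonal to
  -- `w ∈ ker A`, pairing with `k` shows that adding `w` to `W` creates no new radical vectors,
  -- while `k` is lost.
  obtain ⟨W, hW, hWf, hWm⟩ := Nat.sInf_mem hne
  refine ⟨W, hW, hWf, fun k hk w hw => ?_⟩
  by_contra hkw
  have h1 : kerRadical A Q (W ⊔ ℝ ∙ w) < kerRadical A Q W := by
    have hwW : w ∈ W ⊔ ℝ ∙ w := Submodule.mem_sup_right (Submodule.mem_span_singleton_self w)
    refine lt_of_le_of_ne (fun x hx => ?_) fun heq => ?_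
    · obtain ⟨hx1, hx2, hx3⟩ := hx
      obtain ⟨u, hu, y, hy, rfl⟩ := Submodule.mem_sup.1 hx1
      obtain ⟨c, rfl⟩ := Submodule.mem_span_singleton.1 hy
      have hu0 : A u = 0 := by simpa [hw] using hx2
      have h2 := hx3 k (Submodule.mem_sup_left hk.1) hk.2.1
      rw [map_add, map_smul, LinearMap.add_apply, LinearMap.smul_apply, hQ u k, hk.2.2 u hu hu0,
        zero_add, hQ w k, smul_eq_mul, mul_eq_zero, or_iff_left hkw] at h2
      subst h2
      rw [zero_smul, add_zero] at *
      exact ⟨hu, hu0, fun u' hu' => hx3 u' (Submodule.mem_sup_left hu')⟩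
    · rw [← heq] at hk
      exact hkw (hk.2.2 w hwW hw)
  have hfd : FiniteDimensional ℝ (kerRadical A Q W) :=
    Submodule.finiteDimensional_of_le (kerRadical_le A Q W)
  have h2 := Submodule.finrank_lt_finrank_of_lt h1
  have h3 := Nat.sInf_le (s := {m | ∃ W, W₀ ≤ W ∧ FiniteDimensional ℝ W ∧
      finrank ℝ (kerRadical A Q W) = m})
    ⟨W ⊔ ℝ ∙ w, hW.trans le_sup_left, inferInstance, rfl⟩
  omega

/-- Adding to `W` a vector of `ker A` on which `Q` takes the value `s⁻¹`, and which represents on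
`W` the functional `η ∘ A`, transforms the Lagrange plane by a transvection. -/
theorem exists_transvection_mem_lagrangePlane (hQ : ∀ v w, Q v w = Q w v)
    (hind : ∀ (W : Submodule ℝ X) [FiniteDimensional ℝ W] (c : ℝ),
      ∃ z, A z = 0 ∧ (∀ u ∈ W, Q z u = 0) ∧ Q z z = c)
    {W : Submodule ℝ X} [FiniteDimensional ℝ W] {w : X} (hw : A w = 0) {η : StrongDual ℝ B}
    (hη : ∀ u ∈ W, η (A u) = Q w u) (s : ℝ) :
    ∃ W', W ≤ W' ∧ FiniteDimensional ℝ W' ∧ ∀ z ∈ lagrangePlane A Q W,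
      (z.1 + (s * η z.2) • η, z.2) ∈ lagrangePlane A Q W' := by
  by_cases hs : s = 0
  · exact ⟨W, le_rfl, inferInstance, fun z hz => by simpa [hs] using hz⟩
  -- With this square, `x = w + y` satisfies `Q x x = s⁻¹` and still represents `η ∘ A` on `W`. The
  -- equation tested on `x` then fixes its coefficient as `-s * η z.2`.
  obtain ⟨y, hy0, hyW, hyy⟩ := hind (W ⊔ ℝ ∙ w) (s⁻¹ - Q w w)
  have hyw : Q y w = 0 := hyW w (Submodule.mem_sup_right (Submodule.mem_span_singleton_self w))
  set x := w + y with hx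
  have hxA : A x = 0 := by rw [hx, map_add, hw, hy0, add_zero]
  have hxx : Q x x = s⁻¹ := by
    simp only [hx, map_add, LinearMap.add_apply, hQ w y, hyw, hyy]
    ring
  have hxW : ∀ u ∈ W, Q x u = η (A u) := fun u hu => by
    rw [hη u hu, hx, map_add, LinearMap.add_apply, hyW u (Submodule.mem_sup_left hu), add_zero]
  refine ⟨W ⊔ ℝ ∙ x, le_sup_left, inferInstance, ?_⟩
  rintro z ⟨v, hv, hzv, hz⟩
  refine ⟨v - (s * η z.2) • x, Submodule.sub_mem _ (Submodule.mem_sup_left hv)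
    (Submodule.smul_mem _ _ (Submodule.mem_sup_right (Submodule.mem_span_singleton_self x))),
    ?_, fun u' hu' => ?_⟩
  · rw [map_sub, map_smul, hxA, smul_zero, sub_zero]
    exact hzv
  · obtain ⟨u, hu, y', hy', rfl⟩ := Submodule.mem_sup.1 hu'
    obtain ⟨c, rfl⟩ := Submodule.mem_span_singleton.1 hy'
    have h1 := hz u hu
    have h2 := hxW u hu
    have h3 : Q v x = η z.2 := by rw [hQ, hxW v hv, hzv]
    simp only [map_add, map_sub, map_smul, LinearMap.sub_apply, LinearMap.smul_apply, hxA, smul_zero,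
      add_zero, add_apply, smul_apply, smul_eq_mul, h2, h3, hxx]
    have h4 : s * s⁻¹ = 1 := mul_inv_cancel₀ hs
    linear_combination h1 - c * η z.2 * h4

variable [FiniteDimensional ℝ B]

/-- If the Lagrange planes of all finite-dimensional spaces that contain `W` are close to a fixed
plane, then transvections act trivially on the plane of `W`. -/
theorem apply_eq_zero_of_near (hQ : ∀ v w, Q v w = Q w v)
    (hind : ∀ (W : Submodule ℝ X) [FiniteDimensional ℝ W] (c : ℝ),
      ∃ z, A z = 0 ∧ (∀ u ∈ W, Q z u = 0) ∧ Q z z = c)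
    {Λ : Submodule ℝ (StrongDual ℝ B × B)} {ε : ℝ} (hε : 0 < ε)
    (hΛ : ∀ Y : Submodule ℝ (StrongDual ℝ B × B),
      (∀ y ∈ Y, ∃ z ∈ Λ, ‖y - z‖ ≤ ε * ‖y‖) → finrank ℝ Y ≤ finrank ℝ Λ)
    {W : Submodule ℝ X} [FiniteDimensional ℝ W] (hd : finrank ℝ (lagrangePlane A Q W) = finrank ℝ Λ)
    (hnear : ∀ W', W ≤ W' → FiniteDimensional ℝ W' →
      ∀ y ∈ lagrangePlane A Q W', ∃ z ∈ Λ, ‖y - z‖ ≤ ε / 2 * ‖y‖)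
    {v w : X} (hv : v ∈ W) (hvW : ∀ u ∈ W, A u = 0 → Q v u = 0)
    (hw : A w = 0) (hwW : ∀ u ∈ W, A u = 0 → Q w u = 0) : Q w v = 0 := by
  by_contra hne
  obtain ⟨ξ, hξ⟩ := exists_strongDual_comp_eq (A := A) W (-Q v) fun u hu hu0 => by
    rw [LinearMap.neg_apply, hvW u hu hu0, neg_zero]
  obtain ⟨η, hη⟩ := exists_strongDual_comp_eq (A := A) W (Q w) hwW
  have hmem : (ξ, A v) ∈ lagrangePlane A Q W :=
    ⟨v, hv, rfl, fun u hu => by rw [hξ u hu, LinearMap.neg_apply, neg_add_cancel]⟩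
  set p : StrongDual ℝ B × B := (ξ, A v) with hp
  have hηv : η p.2 ≠ 0 := by
    rw [hp, hη v hv]
    exact hne
  -- The transvections move vectors along `e`, by any amount off the hyperplane `η = 0`. So the
  -- plane of `W` enlarged by `e` is close to `Λ`, which its dimension forbids.
  let e : StrongDual ℝ B × B := (η, 0)
  have he : e ∉ lagrangePlane A Q W := fun he => by
    have h1 : sympForm B e p = 0 := (orthogonal_lagrangePlane hQ W).ge hmem _ he
    simp only [sympForm_apply, e, map_zero, sub_zero] at h1
    exact hηv h1
  -- vectors outside the hyperplane `η = 0`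
  have hout : ∀ z ∈ lagrangePlane A Q W, η z.2 ≠ 0 → ∀ a : ℝ,
      ∃ x ∈ Λ, ‖z + a • e - x‖ ≤ ε / 2 * ‖z + a • e‖ := by
    intro z hz hz0 a
    obtain ⟨W', hWW', hW', hmem'⟩ :=
      exists_transvection_mem_lagrangePlane hQ hind hw hη (a / η z.2)
    have h1 : z + a • e = (z.1 + (a / η z.2 * η z.2) • η, z.2) := by
      rw [div_mul_cancel₀ _ hz0]
      exact Prod.ext rfl (by simp [e])
    rw [h1]
    exact hnear W' hWW' hW' _ (hmem' z hz)
  have hall : ∀ y ∈ lagrangePlane A Q W ⊔ ℝ ∙ e, ∃ x ∈ Λ, ‖y - x‖ ≤ ε * ‖y‖ := by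
    intro y hy
    obtain ⟨z, hz, e', he', rfl⟩ := Submodule.mem_sup.1 hy
    obtain ⟨a, rfl⟩ := Submodule.mem_span_singleton.1 he'
    by_cases hz0 : η z.2 = 0
    · by_cases hy0 : z + a • e = 0
      · exact ⟨0, Λ.zero_mem, by simp [hy0]⟩
      have hn : 0 < ‖z + a • e‖ := norm_pos_iff.2 hy0
      set y := z + a • e with hydef
      -- A shift by `t • p` leaves the hyperplane `η = 0`; `t` is so small that the shift costs at
      -- most the other half of `ε * ‖y‖`.
      set t := ε / 2 * ‖y‖ / ((1 + ε) * (‖p‖ + 1)) with ht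
      have ht0 : 0 < t := by positivity
      have htp : (1 + ε) * (t * ‖p‖) ≤ ε / 2 * ‖y‖ := by
        have h1 : (1 + ε) * (t * (‖p‖ + 1)) = ε / 2 * ‖y‖ := by
          rw [ht]
          field_simp
        have h2 : 0 ≤ (1 + ε) * t := by positivity
        nlinarith
      obtain ⟨x, hx, hxn⟩ := hout (z + t • p) (add_mem hz (Submodule.smul_mem _ _ hmem))
        (by
          rw [Prod.snd_add, Prod.smul_snd, map_add, map_smul, hz0, zero_add]
          exact mul_ne_zero ht0.ne' hηv) a
      have h1 : z + t • p + a • e = y + t • p := by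
        rw [hydef]
        abel
      rw [h1] at hxn
      refine ⟨x, hx, ?_⟩
      have htn : ‖t • p‖ = t * ‖p‖ := by rw [norm_smul, Real.norm_eq_abs, abs_of_pos ht0]
      have h2 : ‖y + t • p‖ ≤ ‖y‖ + t * ‖p‖ := htn ▸ norm_add_le _ _
      have h3 : ‖y - x‖ ≤ ‖y + t • p - x‖ + t * ‖p‖ := by
        have h4 : y - x = (y + t • p - x) - t • p := by abel
        rw [h4, ← htn]
        exact norm_sub_le _ _
      have h5 : 0 ≤ t * ‖p‖ := by positivity
      nlinarith
    · obtain ⟨x, hx, hxn⟩ := hout z hz hz0 a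
      exact ⟨x, hx, hxn.trans (by nlinarith [norm_nonneg (z + a • e)])⟩
  have h1 := hΛ _ hall
  have h2 : finrank ℝ (lagrangePlane A Q W) <
      finrank ℝ (lagrangePlane A Q W ⊔ ℝ ∙ e : Submodule ℝ (StrongDual ℝ B × B)) := by
    refine Submodule.finrank_lt_finrank_of_lt (lt_of_le_of_ne le_sup_left fun heq => he ?_)
    rw [heq]
    exact Submodule.mem_sup_right (Submodule.mem_span_singleton_self e)
  omega

/-- If `Q` is indefinite on all subspaces of finite codimension of `ker A` and the Lagrange planes
converge, then every vector of the limit comes from a vector of a fixed finite-dimensional space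
and satisfies the equation for all variations. -/
theorem exists_forall_of_tendsto_of_indefinite (hQ : ∀ v w, Q v w = Q w v)
    (hind : ∀ (W : Submodule ℝ X) [FiniteDimensional ℝ W] (c : ℝ),
      ∃ z, A z = 0 ∧ (∀ u ∈ W, Q z u = 0) ∧ Q z z = c)
    {Λ : Submodule ℝ (StrongDual ℝ B × B)}
    (h : Tendsto (fun W : FinDimSub (⊤ : Submodule ℝ X) => lagrangePlane A Q W.1) atTop
      (grassmannNhds Λ)) :
    ∃ W : Submodule ℝ X, FiniteDimensional ℝ W ∧ ∀ z ∈ Λ, ∃ v ∈ W, z.2 = A v ∧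
      ∀ w, z.1 (A w) + Q v w = 0 := by
  obtain ⟨ε, hε, hΛ⟩ := exists_finrank_le_of_near Λ
  obtain ⟨W₀, hW₀⟩ := eventually_atTop.1 (eventually_near_of_tendsto_grassmannNhds h (half_pos hε))
  have := W₀.2.2
  obtain ⟨s, hs⟩ := A.rangeRestrict.exists_rightInverse_of_surjective A.range_rangeRestrict
  obtain ⟨W, hW, hWf, hWr⟩ := exists_le_kerRadical_orthogonal A hQ (W₀.1 ⊔ s.range)
  have hdim : ∀ W', W ≤ W' → FiniteDimensional ℝ W' →
      finrank ℝ (lagrangePlane A Q W') = finrank ℝ Λ ∧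
      ∀ y ∈ lagrangePlane A Q W', ∃ z ∈ Λ, ‖y - z‖ ≤ ε / 2 * ‖y‖ := fun W' hWW' hW' => by
    have := hW₀ ⟨W', le_top, hW'⟩ ((le_sup_left.trans hW).trans hWW')
    exact ⟨this.1, this.2.2⟩
  -- the admissible variations in `W` are orthogonal to `ker A`
  have hker : ∀ v ∈ W, (∀ u ∈ W, A u = 0 → Q v u = 0) → ∀ w, A w = 0 → Q v w = 0 := by
    intro v hv hvW
    have : FiniteDimensional ℝ (W ⊓ A.ker : Submodule ℝ X) :=
      Submodule.finiteDimensional_of_le inf_le_left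
    -- On `ker A` the functional `Q v` is represented by some `k ∈ W ∩ ker A`. This `k` lies in the
    -- radical, so by the choice of `W` it is orthogonal to all of `ker A`.
    obtain ⟨k, hk, hkv⟩ := exists_mem_forall_eq Q (W ⊓ A.ker) A.ker (Q v) fun w hw hwW => by
      rw [hQ]
      exact apply_eq_zero_of_near hQ hind hε hΛ (hdim W le_rfl hWf).1
        (fun W' h1 h2 => (hdim W' h1 h2).2) hv hvW hw fun u hu hu0 => by
          rw [hQ]
          exact hwW u ⟨hu, hu0⟩
    have hkr : k ∈ kerRadical A Q W := ⟨hk.1, hk.2, fun u hu hu0 => by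
      rw [hkv u hu0]
      exact hvW u hu hu0⟩
    intro w hw
    rw [← hkv w hw]
    exact hWr k hkr w hw
  have hglobal : ∀ z ∈ lagrangePlane A Q W, ∃ v ∈ W, z.2 = A v ∧
      ∀ w, z.1 (A w) + Q v w = 0 := by
    rintro z ⟨v, hv, hzv, hz⟩
    refine ⟨v, hv, hzv, fun w => ?_⟩
    -- `W` contains the range of a section of `A`, so any `w` differs from an element of `W` by an
    -- element of `ker A`.
    set y : X := s (A.rangeRestrict w) with hy
    have hyW : y ∈ W := hW (Submodule.mem_sup_right ⟨_, rfl⟩)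
    have hAy : A y = A w := congrArg Subtype.val (LinearMap.congr_fun hs (A.rangeRestrict w))
    have h1 := hz y hyW
    have h2 := hker v hv (fun u hu hu0 => by simpa [hu0] using hz u hu) (w - y)
      (by rw [map_sub, hAy, sub_self])
    rw [map_sub] at h2
    rw [hAy] at h1
    linarith
  refine ⟨W, hWf, fun z hz => hglobal z ?_⟩
  have hconst : ∀ W', W ≤ W' → FiniteDimensional ℝ W' →
      lagrangePlane A Q W' = lagrangePlane A Q W := fun W' hWW' hW' => by
    refine (Submodule.eq_of_le_of_finrank_le (fun z hz => ?_) ?_).symm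
    · obtain ⟨v, hv, hzv, hz⟩ := hglobal z hz
      exact ⟨v, hWW' hv, hzv, fun w _ => hz w⟩
    · rw [(hdim W' hWW' hW').1, (hdim W le_rfl hWf).1]
  have hcl : IsClosed (lagrangePlane A Q W : Set (StrongDual ℝ B × B)) :=
    Submodule.closed_of_finiteDimensional _
  rw [← SetLike.mem_coe, ← hcl.closure_eq, Metric.mem_closure_iff]
  intro δ hδ
  have hδ' : 0 < δ / (2 * (‖z‖ + 1)) := by positivity
  obtain ⟨W₁, hW₁⟩ := eventually_atTop.1 (eventually_near_of_tendsto_grassmannNhds h hδ')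
  have := W₁.2.2
  obtain ⟨z', hz', hzz'⟩ := (hW₁ ⟨W₁.1 ⊔ W, le_top, inferInstance⟩ (le_sup_left (a := W₁.1))).2.1 z hz
  rw [hconst _ le_sup_right inferInstance] at hz'
  refine ⟨z', hz', ?_⟩
  rw [dist_eq_norm]
  refine hzz'.trans_lt ?_
  rw [div_mul_eq_mul_div, div_lt_iff₀ (by positivity)]
  nlinarith [norm_nonneg z]

end Indefinite

/-- Were the bound false, `x` would be at least `t`, and the right-hand side at most `(a + b) * t *
x < x ^ 2`. -/
theorem le_mul_of_sq_le {x a b t : ℝ} (ht : 0 ≤ t) (ha : 0 ≤ a) (hb : 0 ≤ b)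
    (h : x ^ 2 ≤ t * (a * t + b * x)) : x ≤ (a + b + 1) * t := by
  by_contra hlt
  push Not at hlt
  have h1 : t ≤ x := by nlinarith [mul_nonneg (add_nonneg ha hb) ht]
  have h2 : a * t ≤ a * x := mul_le_mul_of_nonneg_left h1 ha
  have h3 : t * (a * t + b * x) ≤ t * ((a + b) * x) := mul_le_mul_of_nonneg_left (by linarith) ht
  have h4 : 0 < x := lt_of_le_of_lt (by positivity) hlt
  have h5 : (a + b + 1) * t * x < x * x := mul_lt_mul_of_pos_right hlt h4
  nlinarith [mul_nonneg ht h4.le]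

/-! ### One index finite: approximate solutions measured in the seminorm -/

section Semidefinite

variable {X : Type*} [AddCommGroup X] [Module ℝ X]
variable {E : Type*} [NormedAddCommGroup E] [NormedSpace ℝ E]
variable {E' : Type*} [NormedAddCommGroup E'] [NormedSpace ℝ E']
variable {A₀ : X →ₗ[ℝ] E} {A₁ : X →ₗ[ℝ] E'} {Q : X →ₗ[ℝ] X →ₗ[ℝ] ℝ} {S : Submodule ℝ E}
variable {τ : E →ₗ[ℝ] X}

/-- The correction `v - τ (A₀ v)` moves a variation into `A₀⁻¹(S)`. -/
theorem sub_mem_comap (hτ : ∀ e, e - A₀ (τ e) ∈ S) (v : X) :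
    v - τ (A₀ v) ∈ S.comap A₀ := by
  rw [Submodule.mem_comap, map_sub]
  exact hτ _

variable [FiniteDimensional ℝ E]

/-- The finite-rank part of the data: `A` and the functionals `Q(τ e, ·)`. -/
def finiteRankPart (A₀ : X →ₗ[ℝ] E) (A₁ : X →ₗ[ℝ] E') (Q : X →ₗ[ℝ] X →ₗ[ℝ] ℝ) (τ : E →ₗ[ℝ] X) :
    X →ₗ[ℝ] (E × E') × StrongDual ℝ E :=
  (A₀.prod A₁).prod ((LinearMap.toContinuousLinearMap (𝕜 := ℝ) (E := E) (F' := ℝ)).toLinearMap ∘ₗ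
    LinearMap.lcomp ℝ ℝ τ ∘ₗ LinearMap.flip Q)

theorem norm_prod_le_finiteRankPart (w : X) :
    ‖A₀.prod A₁ w‖ ≤ ‖finiteRankPart A₀ A₁ Q τ w‖ := le_max_left _ _

theorem abs_le_finiteRankPart (e : E) (w : X) :
    |Q (τ e) w| ≤ ‖finiteRankPart A₀ A₁ Q τ w‖ * ‖e‖ :=
  ((finiteRankPart A₀ A₁ Q τ w).2.le_opNorm e).trans
    (mul_le_mul_of_nonneg_right (le_max_right _ _) (norm_nonneg _))

/-- The corrected variations that correspond to close vectors of two Lagrange planes are close in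
the seminorm `g`. -/
theorem seminorm_sub_le (hQ : ∀ v w, Q v w = Q w v)
    {g : Seminorm ℝ (S.comap A₀)} {P : S.comap A₀ →ₗ[ℝ] S.comap A₀}
    (hg : ∀ v : S.comap A₀, g v ^ 2 ≤ |Q v v - 2 * Q v (P v)|)
    {K C : ℝ} (hK0 : 0 ≤ K) (hC0 : 0 ≤ C) (hK : ∀ e, ‖finiteRankPart A₀ A₁ Q τ (τ e)‖ ≤ K * ‖e‖)
    (hC : ∀ v, ‖finiteRankPart A₀ A₁ Q τ (P v)‖ ≤ C * g v)
    {W W' : Submodule ℝ X} (hWW' : W ≤ W') (hPW : ∀ v, (P v : X) ∈ W) (hτW : ∀ e, τ e ∈ W)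
    {v v' : X} (hv : v ∈ W) (hv' : v' ∈ W') {ξ ξ' : StrongDual ℝ (E × E')}
    (h : ∀ w ∈ W, ξ (A₀.prod A₁ w) + Q v w = 0)
    (h' : ∀ w ∈ W', ξ' (A₀.prod A₁ w) + Q v' w = 0)
    {m t : ℝ} (ht : 0 ≤ t) (ht1 : t ≤ 1) (hm : ‖ξ'‖ ≤ m) (hm' : ‖A₀.prod A₁ v‖ ≤ m)
    (hξ : ‖ξ' - ξ‖ ≤ 2 * t ^ 2) (hA : ‖A₀.prod A₁ v' - A₀.prod A₁ v‖ ≤ 2 * t ^ 2)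
    {d : S.comap A₀} (hd : (d : X) = v' - v - τ (A₀ (v' - v))) :
    g d ≤ (4 * m + 12 * K + 8 * C + 1) * t := by
  set Θ := finiteRankPart A₀ A₁ Q τ with hΘ
  set A := A₀.prod A₁ with hAdef
  set e := v' - v with he
  set δ := A₀ e with hδ
  have hm0 : 0 ≤ m := (norm_nonneg _).trans hm
  have ht2 : t ^ 2 ≤ 1 := pow_le_one₀ ht ht1
  have ht20 : 0 ≤ t ^ 2 := sq_nonneg t
  have hAe : ‖A e‖ ≤ 2 * t ^ 2 := by rwa [he, map_sub]
  have hδn : ‖δ‖ ≤ 2 * t ^ 2 := (le_max_left _ _ : ‖(A e).1‖ ≤ ‖A e‖).trans hAe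
  have hAΘ : ∀ w, ‖A w‖ ≤ ‖Θ w‖ := fun w => norm_prod_le_finiteRankPart w
  have hQΘ : ∀ e w, |Q (τ e) w| ≤ ‖Θ w‖ * ‖e‖ := fun e w => abs_le_finiteRankPart e w
  -- the difference of the two equations
  have hQe : ∀ w ∈ W, Q e w = -(ξ' - ξ) (A w) := fun w hw => by
    have h1 := h w hw
    have h2 := h' w (hWW' hw)
    rw [he, map_sub, LinearMap.sub_apply, sub_apply]
    linarith
  have hQeb : ∀ w ∈ W, |Q e w| ≤ 2 * t ^ 2 * ‖A w‖ := fun w hw => by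
    rw [hQe w hw, abs_neg]
    exact ((ξ' - ξ).le_opNorm _).trans (mul_le_mul_of_nonneg_right hξ (norm_nonneg _))
  -- The vector `v'` need not lie in `W`, so only the equation of `v'` is tested on both vectors,
  -- and that of `v` on `v` alone.
  have hee : |Q e e| ≤ 4 * m * t ^ 2 := by
    have h1 : Q e e = -ξ' (A e) + (ξ' - ξ) (A v) := by
      have e1 := h' v' hv'
      have e2 := h' v (hWW' hv)
      have e3 := h v hv
      simp only [he, map_sub, LinearMap.sub_apply, sub_apply]
      rw [hQ v v']
      linarith
    have h2 : |ξ' (A e)| ≤ m * (2 * t ^ 2) := (ξ'.le_opNorm _).trans (by gcongr)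
    have h3 : |(ξ' - ξ) (A v)| ≤ 2 * t ^ 2 * m := ((ξ' - ξ).le_opNorm _).trans (by gcongr)
    have h4 := abs_add_le (-ξ' (A e)) ((ξ' - ξ) (A v))
    rw [abs_neg] at h4
    rw [h1]
    linarith
  have hΘδ : ‖Θ (τ δ)‖ ≤ 2 * K * t ^ 2 := (hK δ).trans (by nlinarith)
  have hΘδ' : 2 * t ^ 2 * ‖Θ (τ δ)‖ ≤ 4 * K * t ^ 2 := by
    have : 2 * t ^ 2 * ‖Θ (τ δ)‖ ≤ 2 * 1 * ‖Θ (τ δ)‖ := by gcongr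
    linarith
  have hec : |Q e (τ δ)| ≤ 4 * K * t ^ 2 :=
    (hQeb _ (hτW δ)).trans ((mul_le_mul_of_nonneg_left (hAΘ _) (by positivity)).trans hΘδ')
  have hcc : |Q (τ δ) (τ δ)| ≤ 4 * K * t ^ 2 :=
    (hQΘ δ (τ δ)).trans ((mul_le_mul_of_nonneg_left hδn (norm_nonneg _)).trans (by linarith))
  have hdd : |Q d d| ≤ (4 * m + 12 * K) * t ^ 2 := by
    have h1 : Q d d = Q e e - 2 * Q e (τ δ) + Q (τ δ) (τ δ) := by
      rw [hd]
      simp only [map_sub, LinearMap.sub_apply]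
      rw [hQ (τ δ) e]
      ring
    rw [h1]
    have h2 := abs_le.1 hee
    have h3 := abs_le.1 hec
    have h4 := abs_le.1 hcc
    exact abs_le.2 ⟨by linarith, by linarith⟩
  have hdP : |Q d (P d)| ≤ 4 * C * t ^ 2 * g d := by
    have h1 : Q d (P d) = Q e (P d) - Q (τ δ) (P d) := by
      rw [hd, map_sub, LinearMap.sub_apply]
    have h2 : |Q e (P d)| ≤ 2 * t ^ 2 * (C * g d) := (hQeb _ (hPW d)).trans
      (mul_le_mul_of_nonneg_left ((hAΘ _).trans (hC d)) (by positivity))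
    have h3 : |Q (τ δ) (P d)| ≤ C * g d * (2 * t ^ 2) := (hQΘ δ _).trans
      (mul_le_mul (hC d) hδn (norm_nonneg _) (mul_nonneg hC0 (apply_nonneg g d)))
    rw [h1]
    exact (abs_sub _ _).trans (by linarith)
  -- Since `g` is the root of a quadratic quantity, closeness `t ^ 2` of the plane vectors yields
  -- only order `t` here.
  refine le_mul_of_sq_le ht (by positivity) (by positivity) ((hg d).trans ?_)
  have h1 := abs_sub (Q d d) (2 * Q d (P d))
  rw [abs_mul, abs_two] at h1
  have h2 : t ^ 2 * (C * g d) ≤ t * (C * g d) :=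
    mul_le_mul_of_nonneg_right (by nlinarith) (mul_nonneg hC0 (apply_nonneg g d))
  linarith

variable [FiniteDimensional ℝ E']

/-- If `Q` or `-Q` has a finite index on `A₀⁻¹(S)`, then every vector of the reduction of the limit
of Lagrange planes comes from approximate solutions of the equation on `A₀⁻¹(S)`. -/
theorem exists_approx_of_mem_reduction (hQ : ∀ v w, Q v w = Q w v) (hτ : ∀ e, e - A₀ (τ e) ∈ S)
    (hτS : ∀ e ∈ S, τ e = 0)
    {g : Seminorm ℝ (S.comap A₀)} {P : S.comap A₀ →ₗ[ℝ] S.comap A₀}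
    {N : Submodule ℝ (S.comap A₀)} [FiniteDimensional ℝ N] (hPN : ∀ v, P v ∈ N)
    (hg : ∀ v : S.comap A₀, g v ^ 2 ≤ |Q v v - 2 * Q v (P v)|)
    (hQg : ∀ v w : S.comap A₀, |Q v w| ≤ g v * g w)
    {C : ℝ} (hC0 : 0 ≤ C) (hC : ∀ v, ‖finiteRankPart A₀ A₁ Q τ (P v)‖ ≤ C * g v)
    {Λ : Submodule ℝ (StrongDual ℝ (E × E') × (E × E'))}
    (hΛ : Tendsto (fun W : FinDimSub (⊤ : Submodule ℝ X) => lagrangePlane (A₀.prod A₁) Q W.1) atTop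
      (grassmannNhds Λ))
    {z : StrongDual ℝ E' × E'} (hz : z ∈ (Λ ⊓ (annihilatorProd S).comap proj₀).map proj₁)
    {ε : ℝ} (hε : 0 < ε) :
    ∃ r : S.comap A₀, ‖z.2 - A₁ r‖ ≤ ε ∧
      ∀ w : S.comap A₀, |z.1 (A₁ w) + Q r w| ≤ ε * (g w + ‖A₁ w‖) := by
  obtain ⟨ξ₀, x₀, hx₀, hξ₀, hZ⟩ := mem_reduction.1 hz
  set A := A₀.prod A₁ with hAdef
  set Θ := finiteRankPart A₀ A₁ Q τ with hΘ
  set ξ : StrongDual ℝ (E × E') := ξ₀.coprod z.1 with hξ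
  set x : E × E' := (x₀, z.2) with hx
  obtain ⟨K, hK0, hK⟩ : ∃ K, 0 ≤ K ∧ ∀ e, ‖Θ (τ e)‖ ≤ K * ‖e‖ :=
    ⟨_, norm_nonneg _, (LinearMap.toContinuousLinearMap (Θ ∘ₗ τ)).le_opNorm⟩
  have hAΘ : ∀ w, ‖A w‖ ≤ ‖Θ w‖ := fun w => norm_prod_le_finiteRankPart w
  have hA₁A : ∀ w, ‖A₁ w‖ ≤ ‖A w‖ := fun w => le_max_right _ _
  have hQΘ : ∀ e w, |Q (τ e) w| ≤ ‖Θ w‖ * ‖e‖ := fun e w => abs_le_finiteRankPart e w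
  have hξw : ∀ w ∈ S.comap A₀, ξ (A w) = z.1 (A₁ w) := fun w hw => by
    change ξ₀ (A₀ w) + z.1 (A₁ w) = _
    rw [hξ₀ _ hw, zero_add]
  let ρ : Seminorm ℝ (S.comap A₀) :=
    g + (normSeminorm ℝ E').comp (A₁ ∘ₗ (S.comap A₀).subtype)
  have hρ : ∀ w, ρ w = g w + ‖A₁ w‖ := fun w => rfl
  obtain ⟨D, hD0, hD⟩ := exists_bound_of_le_add_norm ρ (Θ ∘ₗ (S.comap A₀).subtype)
  set m := ‖ξ‖ + ‖x‖ + 1 with hm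
  have hm0 : 0 ≤ m := by positivity
  set L := 4 * m + 12 * K + 8 * C + 1 with hL
  have hL0 : 0 ≤ L := by positivity
  -- The first summand bounds the error of the equation after the finite-rank term is removed, the
  -- second the error of the endpoint.
  set R := D * (L + 2) + (1 + K) with hR
  have hR0 : 0 < R := by positivity
  obtain ⟨t, ht0, ht1, htR⟩ : ∃ t : ℝ, 0 < t ∧ t ≤ 1 ∧ R * t ≤ ε := by
    refine ⟨min 1 (ε / R), by positivity, min_le_left _ _, ?_⟩
    calc R * min 1 (ε / R) ≤ R * (ε / R) := mul_le_mul_of_nonneg_left (min_le_right _ _) hR0.le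
      _ = ε := by field_simp
  have ht2 : t ^ 2 ≤ t := by nlinarith
  have ht20 : 0 ≤ t ^ 2 := sq_nonneg t
  have hδ : 0 < t ^ 2 / (‖(ξ, x)‖ + 1) := by positivity
  obtain ⟨W₀, hW₀⟩ := eventually_atTop.1 (eventually_near_of_tendsto_grassmannNhds hΛ hδ)
  have := W₀.2.2
  have hnear : ∀ W, W₀.1 ≤ W → FiniteDimensional ℝ W → ∃ (ξ' : StrongDual ℝ (E × E')) (v' : X),
      v' ∈ W ∧ (∀ w ∈ W, ξ' (A w) + Q v' w = 0) ∧ ‖ξ - ξ'‖ ≤ t ^ 2 ∧ ‖x - A v'‖ ≤ t ^ 2 := by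
    intro W hW hWf
    obtain ⟨z', ⟨v', hv', hz'v, hz'⟩, hzz'⟩ := (hW₀ ⟨W, le_top, hWf⟩ hW).2.1 _ hZ
    have h1 : ‖(ξ, x) - z'‖ ≤ t ^ 2 := hzz'.trans (by
      rw [div_mul_eq_mul_div, div_le_iff₀ (by positivity)]
      nlinarith [norm_nonneg (ξ, x)])
    refine ⟨z'.1, v', hv', hz', (norm_fst_le ((ξ, x) - z')).trans h1, ?_⟩
    rw [← hz'v]
    exact (norm_snd_le ((ξ, x) - z')).trans h1
  -- a fixed approximate solution
  set W₁ := W₀.1 ⊔ N.map (S.comap A₀).subtype ⊔ τ.range with hW₁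
  have hW₁f : FiniteDimensional ℝ W₁ := inferInstance
  have hPW₁ : ∀ v, (P v : X) ∈ W₁ := fun v =>
    Submodule.mem_sup_left (Submodule.mem_sup_right ⟨P v, hPN v, rfl⟩)
  have hτW₁ : ∀ e, τ e ∈ W₁ := fun e => Submodule.mem_sup_right ⟨e, rfl⟩
  have hW₀₁ : W₀.1 ≤ W₁ := le_sup_left.trans le_sup_left
  obtain ⟨ξ', v', hv', hv'eq, hξ', hxv'⟩ := hnear W₁ hW₀₁ hW₁f
  set r : S.comap A₀ := ⟨v' - τ (A₀ v'), sub_mem_comap hτ v'⟩ with hr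
  have hτx : ∀ v, ‖x - A v‖ ≤ t ^ 2 → ∃ e, τ (A₀ v) = τ e ∧ ‖e‖ ≤ t ^ 2 := fun v hv =>
    ⟨A₀ v - x₀, by rw [map_sub, hτS x₀ hx₀, sub_zero], by
      rw [norm_sub_rev]
      exact (le_max_left _ _ : ‖(x - A v).1‖ ≤ ‖x - A v‖).trans hv⟩
  have hrx : ‖z.2 - A₁ r‖ ≤ (1 + K) * t := by
    obtain ⟨e, he, hen⟩ := hτx v' hxv'
    have h1 : z.2 - A₁ r = (x - A v').2 + A₁ (τ e) := by
      rw [hr, ← he]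
      simp only [map_sub]
      change _ = z.2 - A₁ v' + _
      abel
    have h2 : ‖(x - A v').2‖ ≤ t ^ 2 := (norm_snd_le _).trans hxv'
    have h3 : ‖A₁ (τ e)‖ ≤ K * t ^ 2 :=
      ((hA₁A _).trans (hAΘ _)).trans ((hK e).trans (mul_le_mul_of_nonneg_left hen hK0))
    rw [h1]
    refine (norm_add_le _ _).trans ((add_le_add h2 h3).trans ?_)
    nlinarith
  let q : S.comap A₀ →ₗ[ℝ] ℝ :=
    ((z.1 : E' →ₗ[ℝ] ℝ) ∘ₗ A₁ + Q r) ∘ₗ (S.comap A₀).subtype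
  have hq : ∀ w : S.comap A₀, q w = z.1 (A₁ w) + Q r w := fun w => rfl
  have hqΘ : ∀ w : S.comap A₀, |q w| ≤ (L + 2) * t * (ρ w + ‖Θ w‖) := by
    intro w
    -- A second solution, over a space that contains the test vector `w`. It depends on `w`, but the
    -- bound for its distance `d` to the fixed `r` does not.
    obtain ⟨ξ'', v'', hv'', hv''eq, hξ'', hxv''⟩ :=
      hnear (W₁ ⊔ ℝ ∙ (w : X)) (hW₀₁.trans le_sup_left) inferInstance
    set d : S.comap A₀ := ⟨v'' - τ (A₀ v''), sub_mem_comap hτ v''⟩ - r with hd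
    have hgd : g d ≤ L * t := by
      refine seminorm_sub_le hQ hg hK0 hC0 hK hC (le_sup_left : W₁ ≤ W₁ ⊔ ℝ ∙ (w : X)) hPW₁ hτW₁
        hv' hv'' hv'eq hv''eq ht0.le ht1 (m := m) ?_ ?_ ?_ ?_ ?_
      · have h1 : ‖ξ''‖ ≤ ‖ξ‖ + ‖ξ - ξ''‖ := by
          have := norm_sub_le ξ (ξ - ξ'')
          rwa [sub_sub_cancel] at this
        have := norm_nonneg x
        linarith
      · have h1 : ‖A v'‖ ≤ ‖x‖ + ‖x - A v'‖ := by
          have := norm_sub_le x (x - A v')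
          rwa [sub_sub_cancel] at this
        have := norm_nonneg ξ
        linarith
      · have : ξ'' - ξ' = (ξ - ξ') - (ξ - ξ'') := by abel
        rw [this]
        exact (norm_sub_le _ _).trans (by linarith)
      · have : A v'' - A v' = (x - A v') - (x - A v'') := by abel
        rw [this]
        exact (norm_sub_le _ _).trans (by linarith)
      · change v'' - τ (A₀ v'') - (v' - τ (A₀ v')) = _
        rw [map_sub, map_sub]
        abel
    obtain ⟨e, he, hen⟩ := hτx v'' hxv''
    have h1 : q w = (ξ - ξ'') (A w) - Q d w - Q (τ e) w := by
      have h2 := hv''eq w (Submodule.mem_sup_right (Submodule.mem_span_singleton_self _))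
      have h3 : ((d : S.comap A₀) : X) = v'' - τ e - r := by rw [← he]; rfl
      rw [hq, h3, sub_apply, hξw w w.2]
      simp only [map_sub, LinearMap.sub_apply]
      linarith
    have h2 : |(ξ - ξ'') (A w)| ≤ t * ‖Θ w‖ := ((ξ - ξ'').le_opNorm _).trans
      (mul_le_mul (hξ''.trans ht2) (hAΘ w) (norm_nonneg _) ht0.le)
    have h3 : |Q d w| ≤ L * t * g w :=
      (hQg d w).trans (mul_le_mul_of_nonneg_right hgd (apply_nonneg g w))
    have h4 : |Q (τ e) w| ≤ ‖Θ w‖ * t :=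
      (hQΘ e w).trans (mul_le_mul_of_nonneg_left (hen.trans ht2) (norm_nonneg _))
    have h5 : 0 ≤ ‖A₁ w‖ := norm_nonneg _
    have h6 : 0 ≤ L * t * ‖Θ w‖ := by positivity
    have h7 : 0 ≤ (L + 2) * t * ‖A₁ w‖ := by positivity
    have h8 : 0 ≤ t * g w := mul_nonneg ht0.le (apply_nonneg g w)
    have h9 := abs_sub ((ξ - ξ'') (A w) - Q d w) (Q (τ e) w)
    have h10 := abs_sub ((ξ - ξ'') (A w)) (Q d w)
    rw [h1, hρ]
    linarith
  have hqρ : ∀ w, |q w| ≤ D * ((L + 2) * t) * ρ w :=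
    -- This bound depends on `r`, which is harmless: only its existence is needed.
    hD q _ (by positivity) ⟨‖z.1‖ + g r, fun w => by
      have h1 : |z.1 (A₁ w)| ≤ ‖z.1‖ * ‖A₁ w‖ := z.1.le_opNorm _
      have h2 := hQg r w
      have h3 : 0 ≤ ‖z.1‖ * g w := mul_nonneg (norm_nonneg _) (apply_nonneg g w)
      have h4 : 0 ≤ g r * ‖A₁ w‖ := mul_nonneg (apply_nonneg g r) (norm_nonneg _)
      have h5 := abs_add_le (z.1 (A₁ w)) (Q r w)
      rw [hq, hρ]
      linarith⟩ hqΘ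
  have h1 : (1 + K) * t ≤ ε := by
    have : 0 ≤ D * (L + 2) * t := by positivity
    rw [hR] at htR
    linarith
  refine ⟨r, hrx.trans h1, fun w => ?_⟩
  have h2 : D * ((L + 2) * t) ≤ ε := by
    have : 0 ≤ (1 + K) * t := by positivity
    rw [hR] at htR
    linarith
  exact (hqρ w).trans (mul_le_mul_of_nonneg_right h2 (apply_nonneg ρ w))

/-- A vector that comes from approximate solutions of the equation on `A₀⁻¹(S)` is close to the
Lagrange planes over large finite-dimensional subspaces. -/
theorem eventually_near_of_seminorm (hQ : ∀ v w, Q v w = Q w v)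
    {g : Seminorm ℝ (S.comap A₀)} {P : S.comap A₀ →ₗ[ℝ] S.comap A₀}
    {N : Submodule ℝ (S.comap A₀)} [FiniteDimensional ℝ N] (hPN : ∀ v, P v ∈ N)
    (hg : ∀ v : S.comap A₀, g v ^ 2 ≤ |Q v v - 2 * Q v (P v)|)
    {C : ℝ} (hC0 : 0 ≤ C) (hC : ∀ v, ‖finiteRankPart A₀ A₁ Q τ (P v)‖ ≤ C * g v)
    {z : StrongDual ℝ E' × E'}
    (hz : ∀ ε > 0, ∃ r : S.comap A₀, ‖z.2 - A₁ r‖ ≤ ε ∧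
      ∀ w : S.comap A₀, |z.1 (A₁ w) + Q r w| ≤ ε * (g w + ‖A₁ w‖))
    {ε : ℝ} (hε : 0 < ε) :
    ∀ᶠ W : FinDimSub (S.comap A₀) in atTop, ∃ z' ∈ lagrangePlane A₁ Q W.1, ‖z - z'‖ ≤ ε := by
  have hAΘ : ∀ w, ‖A₁ w‖ ≤ ‖finiteRankPart A₀ A₁ Q τ w‖ := fun w =>
    (le_max_right _ _ : _ ≤ ‖A₀.prod A₁ w‖).trans (norm_prod_le_finiteRankPart w)
  -- For `z'` in the plane with variation `y`, the pairing of `z'` with `z` collects `2 * C + 2`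
  -- from `g y` and `1` each from `A₁ y` and from the endpoint error.
  set t := ε / (2 * C + 4) with ht
  have ht0 : 0 < t := by positivity
  obtain ⟨r, hrx, hq⟩ := hz t ht0
  let W₁ : FinDimSub (S.comap A₀) := ⟨N.map (S.comap A₀).subtype ⊔ ℝ ∙ (r : X),
    sup_le (Submodule.map_subtype_le _ _) ((Submodule.span_singleton_le_iff_mem _ _).2 r.2),
    inferInstance⟩
  filter_upwards [eventually_ge_atTop W₁] with W hW
  have hNW : ∀ v, (P v : X) ∈ W.1 := fun v =>
    hW (Submodule.mem_sup_left ⟨P v, hPN v, rfl⟩)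
  have hrW : (r : X) ∈ W.1 := hW (Submodule.mem_sup_right (Submodule.mem_span_singleton_self _))
  have := W.2.2
  refine exists_near_of_abs_sympForm_le (orthogonal_lagrangePlane hQ W.1).le hε.le fun z' hz' => ?_
  obtain ⟨y, hy, hz'y, hz'⟩ := hz'
  set y' : S.comap A₀ := ⟨y, W.2.1 hy⟩ with hy'
  have hζ : ‖z'.1‖ ≤ ‖z'‖ := norm_fst_le z'
  have hA₁y : ‖A₁ y‖ ≤ ‖z'‖ := hz'y ▸ norm_snd_le z'
  have hgy : g y' ≤ (1 + 2 * C + 1) * ‖z'‖ := by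
    refine le_mul_of_sq_le (norm_nonneg _) zero_le_one (by positivity) ((hg y').trans ?_)
    have h1 := hz' y hy
    have h2 := hz' (P y') (hNW y')
    have h3 : Q y y - 2 * Q y (P y') = -(z'.1 (A₁ y)) + 2 * z'.1 (A₁ (P y')) := by linarith
    have h4 : |z'.1 (A₁ y)| ≤ ‖z'‖ * ‖z'‖ := (z'.1.le_opNorm _).trans
      (mul_le_mul hζ hA₁y (norm_nonneg _) (norm_nonneg _))
    have h5 : |z'.1 (A₁ (P y'))| ≤ ‖z'‖ * (C * g y') := (z'.1.le_opNorm _).trans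
      (mul_le_mul hζ ((hAΘ _).trans (hC y')) (norm_nonneg _) (norm_nonneg _))
    have h6 := abs_add_le (-(z'.1 (A₁ y))) (2 * z'.1 (A₁ (P y')))
    rw [abs_neg, abs_mul, abs_two] at h6
    change |Q y y - 2 * Q y (P y')| ≤ _
    rw [h3]
    linarith
  have h1 : sympForm E' z' z = z'.1 (z.2 - A₁ r) - (z.1 (A₁ y) + Q r y) := by
    have h2 := hz' r hrW
    rw [sympForm_apply, hz'y, map_sub, hQ r y]
    linarith
  have h2 : |z'.1 (z.2 - A₁ r)| ≤ ‖z'‖ * t := (z'.1.le_opNorm _).trans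
    (mul_le_mul hζ hrx (norm_nonneg _) (norm_nonneg _))
  have h3 : |z.1 (A₁ y) + Q r y| ≤ t * ((2 * C + 3) * ‖z'‖) :=
    (hq y').trans (mul_le_mul_of_nonneg_left (by linarith) ht0.le)
  have h4 : t * (2 * C + 4) = ε := by
    rw [ht]
    field_simp
  rw [h1, ← h4]
  exact (abs_sub _ _).trans (by linarith)

end Semidefinite

/-! ### Reduction commutes with the limit -/

section Reduction

variable {X : Type*} [AddCommGroup X] [Module ℝ X]
variable {E : Type*} [NormedAddCommGroup E] [NormedSpace ℝ E] [FiniteDimensional ℝ E]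
variable {E' : Type*} [NormedAddCommGroup E'] [NormedSpace ℝ E'] [FiniteDimensional ℝ E']
variable {A₀ : X →ₗ[ℝ] E} {A₁ : X →ₗ[ℝ] E'} {Q : X →ₗ[ℝ] X →ₗ[ℝ] ℝ} {S : Submodule ℝ E}

/-- The sign `s` lets finite index of `Q` and of `-Q` share one argument, since the estimates only
involve absolute values of `Q`. -/
theorem eventually_near_of_isNegDefOn (hQ : ∀ v w, Q v w = Q w v) {τ : E →ₗ[ℝ] X}
    (hτ : ∀ e, e - A₀ (τ e) ∈ S) (hτS : ∀ e ∈ S, τ e = 0) {s : ℝ} (hs : |s| = 1)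
    {N : Submodule ℝ (S.comap A₀)}
    (hN : IsNegDefOn (s • Q.domRestrict₁₂ (S.comap A₀) (S.comap A₀)) N)
    (hmax : ∀ v, (∀ n ∈ N, (s • Q.domRestrict₁₂ (S.comap A₀) (S.comap A₀)) v n = 0) →
      0 ≤ (s • Q.domRestrict₁₂ (S.comap A₀) (S.comap A₀)) v v)
    {Λ : Submodule ℝ (StrongDual ℝ (E × E') × (E × E'))}
    (hΛ : Tendsto (fun W : FinDimSub (⊤ : Submodule ℝ X) => lagrangePlane (A₀.prod A₁) Q W.1) atTop
      (grassmannNhds Λ))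
    {z : StrongDual ℝ E' × E'} (hz : z ∈ (Λ ⊓ (annihilatorProd S).comap proj₀).map proj₁)
    {ε : ℝ} (hε : 0 < ε) :
    ∀ᶠ W : FinDimSub (S.comap A₀) in atTop, ∃ z' ∈ lagrangePlane A₁ Q W.1, ‖z - z'‖ ≤ ε := by
  have := hN.1
  have hb : ∀ v w : S.comap A₀,
      (s • Q.domRestrict₁₂ (S.comap A₀) (S.comap A₀)) v w = s * Q v w := fun v w => rfl
  obtain ⟨g, P, C, hC0, hPN, hg, hQg, hC⟩ := exists_seminorm_of_maximal
    (fun v w => by rw [hb, hb, hQ v w]) hN hmax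
    (finiteRankPart A₀ A₁ Q τ ∘ₗ (S.comap A₀).subtype)
  have hg' : ∀ v : S.comap A₀, g v ^ 2 ≤ |Q v v - 2 * Q v (P v)| := fun v => by
    have h1 : g v ^ 2 = s * (Q v v - 2 * Q v (P v)) := by
      rw [hg, map_sub, map_smul, hb, hb, smul_eq_mul]
      ring
    rw [h1, ← one_mul |_|, ← hs, ← abs_mul]
    exact le_abs_self _
  have hQg' : ∀ v w : S.comap A₀, |Q v w| ≤ g v * g w := fun v w => by
    have := hQg v w
    rwa [hb, abs_mul, hs, one_mul] at this
  exact eventually_near_of_seminorm hQ hPN hg' hC0 hC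
    (fun ε hε => exists_approx_of_mem_reduction hQ hτ hτS hPN hg' hQg' hC0 hC hΛ hz hε) hε

theorem eventually_near_of_index_infinite (hQ : ∀ v w, Q v w = Q w v)
    (hneg : ∀ n : ℕ, ∃ N, IsNegDefOn
      ((1 : ℝ) • Q.domRestrict₁₂ (S.comap A₀) (S.comap A₀)) N ∧ n < finrank ℝ N)
    (hpos : ∀ n : ℕ, ∃ N, IsNegDefOn
      ((-1 : ℝ) • Q.domRestrict₁₂ (S.comap A₀) (S.comap A₀)) N ∧ n < finrank ℝ N)
    {Λ : Submodule ℝ (StrongDual ℝ (E × E') × (E × E'))}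
    (hΛ : Tendsto (fun W : FinDimSub (⊤ : Submodule ℝ X) => lagrangePlane (A₀.prod A₁) Q W.1) atTop
      (grassmannNhds Λ))
    {z : StrongDual ℝ E' × E'} (hz : z ∈ (Λ ⊓ (annihilatorProd S).comap proj₀).map proj₁) :
    ∀ᶠ W : FinDimSub (S.comap A₀) in atTop, z ∈ lagrangePlane A₁ Q W.1 := by
  have hind : ∀ (W : Submodule ℝ X) [FiniteDimensional ℝ W] (c : ℝ),
      ∃ z, A₀.prod A₁ z = 0 ∧ (∀ u ∈ W, Q z u = 0) ∧ Q z z = c := by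
    intro W _ c
    let Θ : S.comap A₀ →ₗ[ℝ] (E × E') × Dual ℝ W :=
      (A₀.prod A₁).prod (W.subtype.dualMap ∘ₗ Q) ∘ₗ (S.comap A₀).subtype
    -- A vector whose square has the sign of `c` is rescaled to have the square `c`.
    have hscale : ∀ y : X, A₀.prod A₁ y = 0 → (∀ u ∈ W, Q y u = 0) → 0 < c / Q y y →
        ∃ z, A₀.prod A₁ z = 0 ∧ (∀ u ∈ W, Q z u = 0) ∧ Q z z = c := by
      intro y hy hyW hyc
      have hne : Q y y ≠ 0 := fun h0 => by simp [h0] at hyc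
      refine ⟨√(c / Q y y) • y, by rw [map_smul, hy, smul_zero], fun u hu => ?_, ?_⟩
      · rw [map_smul, LinearMap.smul_apply, hyW u hu, smul_zero]
      · simp only [map_smul, LinearMap.smul_apply, smul_eq_mul]
        rw [← mul_assoc, Real.mul_self_sqrt hyc.le, div_mul_cancel₀ _ hne]
    have hΘ : ∀ y, Θ y = 0 → A₀.prod A₁ y = 0 ∧ ∀ u ∈ W, Q y u = 0 := fun y hy =>
      ⟨congrArg Prod.fst hy, fun u hu => LinearMap.congr_fun (congrArg Prod.snd hy) ⟨u, hu⟩⟩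
    rcases lt_trichotomy c 0 with hc | rfl | hc
    · obtain ⟨y, hy, hyy⟩ := exists_neg_of_finrank_lt hneg Θ
      have h1 : (1 : ℝ) * Q y y < 0 := hyy
      exact hscale y (hΘ y hy).1 (hΘ y hy).2 (div_pos_of_neg_of_neg hc (by linarith))
    · exact ⟨0, map_zero _, fun u _ => by simp, by simp⟩
    · obtain ⟨y, hy, hyy⟩ := exists_neg_of_finrank_lt hpos Θ
      have h1 : (-1 : ℝ) * Q y y < 0 := hyy
      exact hscale y (hΘ y hy).1 (hΘ y hy).2 (div_pos hc (by linarith))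
  obtain ⟨W₁, hW₁f, hW₁⟩ := exists_forall_of_tendsto_of_indefinite hQ hind hΛ
  obtain ⟨ξ₀, x₀, hx₀, hξ₀, hZ⟩ := mem_reduction.1 hz
  obtain ⟨v, hv, hzv, hvw⟩ := hW₁ _ hZ
  have hvV : v ∈ S.comap A₀ := by
    have h1 : x₀ = A₀ v := congrArg Prod.fst hzv
    rwa [Submodule.mem_comap, ← h1]
  filter_upwards [eventually_ge_atTop (⟨ℝ ∙ v, (Submodule.span_singleton_le_iff_mem _ _).2 hvV,
    inferInstance⟩ : FinDimSub (S.comap A₀))] with W hW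
  refine ⟨v, hW (Submodule.mem_span_singleton_self v), congrArg Prod.snd hzv, fun w hw => ?_⟩
  have h1 : ξ₀ (A₀ w) + z.1 (A₁ w) + Q v w = 0 := hvw w
  rwa [hξ₀ _ (W.2.1 hw), zero_add] at h1

/-- The limit of the Lagrange planes of the problem restricted to `A₀⁻¹(S)` is the reduction of the
limit of the Lagrange planes. -/
theorem tendsto_lagrangePlane_reduction (hQ : ∀ v w, Q v w = Q w v) {σ : E →ₗ[ℝ] X}
    (hσ : ∀ e, A₀ (σ e) = e) {Λ : Submodule ℝ (StrongDual ℝ (E × E') × (E × E'))}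
    (hΛ : Tendsto (fun W : FinDimSub (⊤ : Submodule ℝ X) => lagrangePlane (A₀.prod A₁) Q W.1) atTop
      (grassmannNhds Λ)) :
    Tendsto (fun W : FinDimSub (S.comap A₀) => lagrangePlane A₁ Q W.1) atTop
      (grassmannNhds ((Λ ⊓ (annihilatorProd S).comap proj₀).map proj₁)) := by
  obtain ⟨p, hp⟩ := S.subtype.exists_leftInverse_of_injective S.ker_subtype
  -- Lifts the component along a complement of `S`, so that `v - τ (A₀ v)` lies in `A₀⁻¹(S)` and the
  -- correction is small when `A₀ v` is close to `S`.
  let τ : E →ₗ[ℝ] X := σ ∘ₗ (LinearMap.id - S.subtype ∘ₗ p)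
  have hτ : ∀ e, e - A₀ (τ e) ∈ S := fun e => by
    have h1 : e - A₀ (τ e) = p e := by
      change e - A₀ (σ (e - p e)) = p e
      rw [hσ, sub_sub_cancel]
    rw [h1]
    exact (p e).2
  have hτS : ∀ e ∈ S, τ e = 0 := fun e he => by
    have h1 : p e = ⟨e, he⟩ := LinearMap.congr_fun hp ⟨e, he⟩
    change σ (e - p e) = 0
    rw [h1, sub_self, map_zero]
  have hdim : ∀ W : FinDimSub (S.comap A₀), finrank ℝ (lagrangePlane A₁ Q W.1) = finrank ℝ E' :=
    fun W => by
      have := W.2.2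
      exact finrank_lagrangePlane hQ W.1
  have hLag : (sympForm (E × E')).orthogonal Λ = Λ := orthogonal_eq_of_tendsto (fun W => by
    have := W.2.2
    exact orthogonal_lagrangePlane hQ W.1) hΛ
  refine tendsto_grassmannNhds_of_near (Eventually.of_forall fun W => ?_) fun z hz ε hε => ?_
  · rw [hdim W]
    exact le_finrank_of_coisotropic (orthogonal_reduction_le S hLag)
  have hb : ∀ s : ℝ, ∀ v w, (s • Q.domRestrict₁₂ (S.comap A₀) (S.comap A₀)) v w =
      (s • Q.domRestrict₁₂ (S.comap A₀) (S.comap A₀)) w v := fun s v w =>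
    congrArg (s * ·) (hQ v w)
  rcases exists_maximal_isNegDefOn_or (hb 1) with ⟨N, hN, hmax⟩ | hneg
  · exact eventually_near_of_isNegDefOn hQ hτ hτS (by simp) hN hmax hΛ hz hε
  rcases exists_maximal_isNegDefOn_or (hb (-1)) with ⟨N, hN, hmax⟩ | hpos
  · exact eventually_near_of_isNegDefOn hQ hτ hτS (by simp) hN hmax hΛ hz hε
  filter_upwards [eventually_near_of_index_infinite hQ hneg hpos hΛ hz] with W hW
  exact ⟨z, hW, by simpa using hε.le⟩

end Reduction

/-! ### Second variations as symmetric forms -/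

section Jets

variable {X : Type*} [NormedAddCommGroup X] [NormedSpace ℝ X]
variable {B : Type*} [NormedAddCommGroup B] [NormedSpace ℝ B]
variable {B' : Type*} [NormedAddCommGroup B'] [NormedSpace ℝ B']

theorem secondDiff_symm (g : X → B) (x v w : X) : secondDiff g x v w = secondDiff g x w v := by
  simp only [secondDiff, smul_apply, add_apply, ContinuousLinearMap.flip_apply]
  rw [add_comm]

/-- The second variation as a bilinear map. -/
def secondVariationForm (g : X → B) (j : X → ℝ) (x : X) (p : StrongDual ℝ B) (ν : ℝ) :
    X →ₗ[ℝ] X →ₗ[ℝ] ℝ :=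
  LinearMap.mk₂ ℝ (secondVariation (TwoJet.of g j x) p ν)
    (fun a b c => by simp [secondVariation]; ring) (fun c a b => by simp [secondVariation]; ring)
    (fun a b c => by simp [secondVariation]; ring) (fun c a b => by simp [secondVariation]; ring)

theorem secondVariationForm_symm (g : X → B) (j : X → ℝ) (x : X) (p : StrongDual ℝ B) (ν : ℝ)
    (v w : X) : secondVariationForm g j x p ν v w = secondVariationForm g j x p ν w v := by
  change p (secondDiff g x v w) - ν * secondDiff j x v w =
    p (secondDiff g x w v) - ν * secondDiff j x w v
  rw [secondDiff_symm g, secondDiff_symm j]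

theorem lDerivOver_ofPair (g₀ : X → B) (g₁ : X → B') (j : X → ℝ) (x : X) (p₀ : StrongDual ℝ B)
    (p₁ : StrongDual ℝ B') (ν : ℝ) (h : secondDiff g₀ x = 0) (W : Submodule ℝ X) :
    lDerivOver (TwoJet.ofPair g₀ g₁ j x) (p₀.coprod p₁) ν W =
      lagrangePlane ((fderiv ℝ g₀ x : X →ₗ[ℝ] B).prod (fderiv ℝ g₁ x : X →ₗ[ℝ] B'))
        (secondVariationForm g₁ j x p₁ ν) W := by
  have hQ : ∀ v w, secondVariation (TwoJet.ofPair g₀ g₁ j x) (p₀.coprod p₁) ν v w =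
      secondVariationForm g₁ j x p₁ ν v w := fun v w => by
    change (p₀.coprod p₁) _ - _ = p₁ (secondDiff g₁ x v w) - ν * secondDiff j x v w
    simp [TwoJet.ofPair, h]
  ext z
  change (∃ v ∈ W, _ ∧ ∀ w ∈ W, _ + secondVariation _ _ ν v w = 0) ↔ _
  simp only [hQ]
  rfl

end Jets

/-! ### The initial-point map in the coordinates `(q(t₀), u)` -/

section Control

variable {k : ℕ} {E : Type*} [NormedAddCommGroup E] [NormedSpace ℝ E]
variable {M : Type*} [TopologicalSpace M] [ChartedSpace E M] [IsManifold 𝓘(ℝ, E) ∞ M]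

/-- The default constant curve also passes through `a`, so no existence theorem for trajectories is
needed. -/
theorem trajectory_self (𝒮 : ControlSystem k E M) (T t₀ : ℝ) (a : M) (u : Control k T) :
    𝒮.trajectory T t₀ a u t₀ = a := by
  unfold ControlSystem.trajectory
  split_ifs with h
  · exact h.choose_spec.2
  · rfl

/-- In the coordinates `(q(t₀), u)` the map `F_{t₀}` is the projection to the first component. -/
theorem evalCoord_eventuallyEq_fst (𝒮 : ControlSystem k E M) (T t₀ : ℝ)
    {φ : OpenPartialHomeomorph M E} {x : E} (hx : x ∈ φ.target) (u : Control k T) :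
    𝒮.evalCoord T t₀ φ φ t₀ =ᶠ[𝓝 (x, u)] Prod.fst := by
  have h : Prod.fst ⁻¹' φ.target ∈ 𝓝 (x, u) :=
    continuous_fst.continuousAt.preimage_mem_nhds (φ.open_target.mem_nhds hx)
  filter_upwards [h] with z hz
  rw [ControlSystem.evalCoord, trajectory_self, φ.right_inv hz]

theorem fderiv_evalCoord (𝒮 : ControlSystem k E M) (T t₀ : ℝ)
    {φ : OpenPartialHomeomorph M E} {x : E} (hx : x ∈ φ.target) (u : Control k T) :
    fderiv ℝ (𝒮.evalCoord T t₀ φ φ t₀) (x, u) = ContinuousLinearMap.fst ℝ E (Control k T) :=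
  (evalCoord_eventuallyEq_fst 𝒮 T t₀ hx u).fderiv_eq.trans fderiv_fst

theorem secondDiff_evalCoord (𝒮 : ControlSystem k E M) (T t₀ : ℝ)
    {φ : OpenPartialHomeomorph M E} {x : E} (hx : x ∈ φ.target) (u : Control k T) :
    secondDiff (𝒮.evalCoord T t₀ φ φ t₀) (x, u) = 0 := by
  have h1 : fderiv ℝ (𝒮.evalCoord T t₀ φ φ t₀) =ᶠ[𝓝 (x, u)]
      fun _ => ContinuousLinearMap.fst ℝ E (Control k T) :=
    (evalCoord_eventuallyEq_fst 𝒮 T t₀ hx u).fderiv.trans (Eventually.of_forall fun _ => fderiv_fst)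
  have h2 : fderiv ℝ (fderiv ℝ (𝒮.evalCoord T t₀ φ φ t₀)) (x, u) = 0 := by
    rw [h1.fderiv_eq]
    exact fderiv_const_apply _
  rw [secondDiff, h2]
  refine ContinuousLinearMap.ext fun v => ContinuousLinearMap.ext fun w => ?_
  simp

end Control

end

end LDeriv

theorem mainTheorem11
    {E : Type*} [NormedAddCommGroup E] [NormedSpace ℝ E] [FiniteDimensional ℝ E]
    {M : Type*} [TopologicalSpace M] [T2Space M] [ChartedSpace E M] [IsManifold 𝓘(ℝ, E) ∞ M]
    {k : ℕ} (𝒮 : LDeriv.ControlSystem k E M)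
    (T t₀ t₁ : ℝ) (ht₀ : 0 ≤ t₀) (ht : t₀ < t₁) (ht₁ : t₁ ≤ T)
    (q : ℝ → M) (u : LDeriv.Control k T) (hω : 𝒮.IsAdmissible T q u)
    (N₀ : Set M) (hN₀ : LDeriv.IsEmbeddedSubmanifold (E := E) N₀) (hq : q t₀ ∈ N₀)
    -- canonical coordinates on the cotangent bundle over `q t₀` and `q t₁`
    (φ₀ : OpenPartialHomeomorph M E) (S : Submodule ℝ E)
    (hφ₀ : LDeriv.IsSliceChart N₀ φ₀ (q t₀) S)
    (φ₁ : OpenPartialHomeomorph M E) (hφ₁ : φ₁ ∈ IsManifold.maximalAtlas 𝓘(ℝ, E) ∞ M)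
    (hq₁ : q t₁ ∈ φ₁.source)
    (ν : ℝ) (l₀ : TangentSpace 𝓘(ℝ, E) (q t₀) →L[ℝ] ℝ)
    (l₁ : TangentSpace 𝓘(ℝ, E) (q t₁) →L[ℝ] ℝ)
    (p₀ p₁ : StrongDual ℝ E) (hp₀ : p₀ = LDeriv.covectorCoord φ₀ (q t₀) l₀)
    (hp₁ : p₁ = LDeriv.covectorCoord φ₁ (q t₁) l₁)
    (hLagrange : LDeriv.IsLagrangePoint (𝒮.twoPointJet T t₀ t₁ φ₀ φ₁ q u)
      ((-p₀).coprod p₁) ν ⊤)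
    (hl₀ : ∀ v ∈ LDeriv.sliceTangentSpace φ₀ (q t₀) S, l₀ v = 0) :
    LDeriv.IsLagrangePoint (𝒮.endPointJet T t₀ t₁ φ₀ φ₁ q u) p₁ ν
        (𝒮.startTangentSpace T t₀ φ₀ q u S) ∧
      ∀ Λ : Submodule ℝ (StrongDual ℝ (E × E) × (E × E)),
        LDeriv.IsLDerivative (𝒮.twoPointJet T t₀ t₁ φ₀ φ₁ q u)
            ((-p₀).coprod p₁) ν ⊤ Λ →
          LDeriv.IsLDerivative (𝒮.endPointJet T t₀ t₁ φ₀ φ₁ q u) p₁ ν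
            (𝒮.startTangentSpace T t₀ φ₀ q u S)
            ((Λ ⊓ (LDeriv.annihilatorProd S).comap LDeriv.proj₀).map LDeriv.proj₁) := by
  set x : E × LDeriv.Control k T := (φ₀ (q t₀), u) with hx
  have htgt : φ₀ (q t₀) ∈ φ₀.target := φ₀.map_source hφ₀.mem_source
  have hd := LDeriv.fderiv_evalCoord 𝒮 T t₀ htgt u
  have hdd := LDeriv.secondDiff_evalCoord 𝒮 T t₀ htgt u
  constructor
  · intro w hw
    have h1 : p₀ (fderiv ℝ (𝒮.evalCoord T t₀ φ₀ φ₀ t₀) x w) = 0 := by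
      rw [hp₀]
      exact hl₀ _ (Submodule.mem_map_of_mem hw)
    have h2 := hLagrange w Submodule.mem_top
    change (-p₀) (fderiv ℝ (𝒮.evalCoord T t₀ φ₀ φ₀ t₀) x w) +
      p₁ (fderiv ℝ (𝒮.evalCoord T t₀ φ₀ φ₁ t₁) x w) -
      ν * fderiv ℝ (𝒮.costCoord T t₀ t₁ φ₀) x w = 0 at h2
    rwa [neg_apply, h1, neg_zero, zero_add] at h2
  · intro Λ hΛ
    have hΛ' : Tendsto (fun W : LDeriv.FinDimSub (⊤ : Submodule ℝ (E × LDeriv.Control k T)) =>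
        LDeriv.lagrangePlane
          ((fderiv ℝ (𝒮.evalCoord T t₀ φ₀ φ₀ t₀) x : E × LDeriv.Control k T →ₗ[ℝ] E).prod
            (fderiv ℝ (𝒮.evalCoord T t₀ φ₀ φ₁ t₁) x : E × LDeriv.Control k T →ₗ[ℝ] E))
          (LDeriv.secondVariationForm (𝒮.evalCoord T t₀ φ₀ φ₁ t₁)
            (𝒮.costCoord T t₀ t₁ φ₀) x p₁ ν) W.1) atTop (LDeriv.grassmannNhds Λ) :=
      Tendsto.congr (fun W => LDeriv.lDerivOver_ofPair _ _ _ _ (-p₀) p₁ ν hdd W.1) hΛ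
    -- The planes of the end-point problem are Lagrange planes by definition; `x ↦ (x, 0)` is a
    -- right inverse of `dF_{t₀}`.
    exact LDeriv.tendsto_lagrangePlane_reduction (LDeriv.secondVariationForm_symm _ _ _ _ _)
      (σ := LinearMap.inl ℝ E (LDeriv.Control k T)) (fun e => by rw [hd]; rfl) hΛ'
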